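/- **Setting.** An election consists of a set $C$ of $m$ candidates and an ordered list $V=(v_1,\dots,v_n)$ of voters, each with a linear order $\succ_v$ over $C$; $\mathrm{pos}_v(c)\in\{1,\dots,m\}$ is the position of $c$ in the order of $v$. The election is *single-crossing* if for all $a,b\in C$ with $a\succ_{v_1}b$ there is $t\in\{1,\dots,n\}$ with $\{i: a\succ_{v_i} b\}=\{1,\dots,t\}$, and *narcissistic* if every candidate is ranked first by at least one voter. A *dissatisfaction function* for $m$ candidates is a nondecreasing $\alpha:\{1,\dots,m\}\to\mathbb N$ with $\alpha(1)=0$. For $1\le k\le m$, a *$k$-Monroe assignment* is a map $\Phi:V\to C$ with exactly $k$ candidates in its image, each of which is assigned to at least $\lfloor n/k\rfloor$ and at most $\lceil n/k\rceil$ voters. It is *optimal under $\alpha$-$\ell_\infty$-Monroe* if it minimizes $\max_{v\in V}\alpha(\mathrm{pos}_v(\Phi(v)))$ among all $k$-Monroe assignments. It has the *contiguous blocks property* if the voters assigned to each candidate are consecutive in $V$. Running times are numbers of steps of a random access machine in which additions, truncated subtractions, comparisons and (indirect) memory accesses take one step each, and in which memory that does not hold the input is uninitialized. **Theorem.** (i)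 There is an algorithm that, given a single-crossing narcissistic election with $n$ voters and $m$ candidates, an integer $k$ with $1\le k\le m$, and the table of values $\alpha(1),\dots,\alpha(m)$ of a dissatisfaction function for $m$ candidates, finds in time $O(nm^2k)$ an optimal $k$-Monroe assignment under $\alpha$-$\ell_\infty$-Monroe, and one with the contiguous blocks property. (ii) Let $(\alpha^m)_{m\ge1}$ be a polynomial-time computable family of dissatisfaction functions: some program computes $\alpha^m(i)$ from $m$ and $i\in\{1,\dots,m\}$ within $T(m)$ steps, where $T$ is a polynomial with coefficients in $\mathbb N$. Then there is a polynomial-time algorithm that, given a single-crossing narcissistic election with $n$ voters and $m$ candidates and an integer $k$ with $1\le k\le m$, finds an optimal $k$-Monroe assignment under $\alpha^m$-$\ell_\infty$-Monroe, and one with the contiguous blocks property; its running time is $O(nm^2k + m\,T(m))$. -/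

import Mathlib

/-! ### Elections -/

/-- An election with the ordered list of voters `0, …, n - 1` and the candidates `0, …, m - 1`.
The preference order of voter `v` is given as a ranking, a bijection from ranks to candidates:
`ranking v r` is the candidate that has exactly `r` candidates above it. -/
structure Election (n m : ℕ) where
  ranking : Fin n → Fin m ≃ Fin m

namespace Election

variable {n m : ℕ}

/-- The position (counted from `1`) of candidate `c` in the preference order of voter `v`. -/
def pos (E : Election n m) (v : Fin n) (c : Fin m) : ℕ :=
  ((E.ranking v).symm c : ℕ) + 1

/-- Voter `v` prefers `a` to `b`. -/
def Prefers (E : Election n m) (v : Fin n) (a b : Fin m) : Prop :=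
  E.pos v a < E.pos v b

/-- For each pair of candidates `a`, `b` such that the first voter prefers `a` to `b`, the voters
who prefer `a` to `b` are exactly the first `t` voters, for some `1 ≤ t ≤ n`. -/
def SingleCrossing (E : Election n m) : Prop :=
  ∀ (hn : 0 < n) (a b : Fin m), E.Prefers ⟨0, hn⟩ a b →
    ∃ t : ℕ, 1 ≤ t ∧ t ≤ n ∧ ∀ v : Fin n, E.Prefers v a b ↔ (v : ℕ) < t

/-- Every candidate is ranked first by at least one voter. -/
def Narcissistic (E : Election n m) : Prop :=
  ∀ c : Fin m, ∃ v : Fin n, E.pos v c = 1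

/-- The egalitarian aggregate `ℓ_∞(Φ) = max_v α(pos_v(Φ(v)))`. -/
def linfty (E : Election n m) (α : ℕ → ℕ) (Φ : Fin n → Fin m) : ℕ :=
  Finset.univ.sup fun v => α (E.pos v (Φ v))

end Election

/-- Dissatisfaction functions `[m] → ℕ`, as functions on `ℕ` of which only the values on
`{1, …, m}` are relevant. -/
structure IsDissatisfaction (m : ℕ) (α : ℕ → ℕ) : Prop where
  one : α 1 = 0
  mono : MonotoneOn α (Set.Icc 1 m)

/-- A `k`-CC-assignment function uses at most `k` candidates. -/
def IsCCAssignment {n m : ℕ} (k : ℕ) (Φ : Fin n → Fin m) : Prop :=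
  (Finset.univ.image Φ).card ≤ k

/-- A `k`-Monroe-assignment function: exactly `k` candidates are used, each of them for at least
`⌊n / k⌋` and at most `⌈n / k⌉` voters. -/
structure IsMonroeAssignment {n m : ℕ} (k : ℕ) (Φ : Fin n → Fin m) : Prop where
  isCC : IsCCAssignment k Φ
  card_image : (Finset.univ.image Φ).card = k
  card_fiber : ∀ c : Fin m, (Finset.univ.filter fun v => Φ v = c).card = 0 ∨
    (n / k ≤ (Finset.univ.filter fun v => Φ v = c).card ∧
      (Finset.univ.filter fun v => Φ v = c).card ≤ n ⌈/⌉ k)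

/-- `Φ` is an optimal `k`-Monroe assignment for `E` under `α`-`ℓ_∞`-Monroe. -/
def Election.IsOptimalMonroe {n m : ℕ} (E : Election n m) (α : ℕ → ℕ) (k : ℕ)
    (Φ : Fin n → Fin m) : Prop :=
  IsMonroeAssignment k Φ ∧
    ∀ Ψ : Fin n → Fin m, IsMonroeAssignment k Ψ → E.linfty α Φ ≤ E.linfty α Ψ

/-- The voters represented by any given candidate are consecutive. -/
def HasContiguousBlocks {n m : ℕ} (Φ : Fin n → Fin m) : Prop :=
  ∀ u v w : Fin n, u ≤ v → v ≤ w → Φ u = Φ w → Φ v = Φ u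

/-! ### Random access machines

Structured programs for a random access machine with unit-cost steps. A program uses finitely many
registers and finitely many unbounded arrays of natural numbers, with indirect addressing. The only
arithmetic is addition, truncated subtraction and comparison (there is no multiplication), so that
a number grows by at most one bit per step and polynomially many steps are polynomial time. -/

/-- A memory state: `reg x` is the content of register `x`, and `arr a i` is the content of cell
`i` of array `a`. -/
structure RAMState where
  reg : ℕ → ℕ
  arr : ℕ → ℕ → ℕ

/-- Write `v` to register `x`. -/
def RAMState.setReg (s : RAMState) (x v : ℕ) : RAMState :=
  { s with reg := Function.update s.reg x v }

/-- Write `v` to cell `i` of array `a`. -/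
def RAMState.setArr (s : RAMState) (a i v : ℕ) : RAMState :=
  { s with arr := Function.update s.arr a (Function.update (s.arr a) i v) }

/-- Programs. Here `x`, `y`, `z` are names of registers, `a` is the name of an array, and `c` is a
numeral. -/
inductive RAMProg : Type
  /-- do nothing -/
  | skip : RAMProg
  /-- `x := c` -/
  | const (x c : ℕ) : RAMProg
  /-- `x := y` -/
  | copy (x y : ℕ) : RAMProg
  /-- `x := y + z` -/
  | add (x y z : ℕ) : RAMProg
  /-- `x := y - z`, truncated at zero -/
  | sub (x y z : ℕ) : RAMProg
  /-- `x := a[y]` -/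
  | load (x a y : ℕ) : RAMProg
  /-- `a[x] := y` -/
  | store (a x y : ℕ) : RAMProg
  /-- sequential composition -/
  | seq (p q : RAMProg) : RAMProg
  /-- `if x < y then p else q` -/
  | ifLt (x y : ℕ) (p q : RAMProg) : RAMProg
  /-- `while x < y do p` -/
  | whileLt (x y : ℕ) (p : RAMProg) : RAMProg

/-- `p.Runs s t s'`: started in the memory state `s`, the program `p` halts in the memory state
`s'` after exactly `t` steps. Every elementary instruction and every test is one step. -/
inductive RAMProg.Runs : RAMProg → RAMState → ℕ → RAMState → Prop
  | skip (s : RAMState) : Runs .skip s 1 s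
  | const (s : RAMState) (x c : ℕ) : Runs (.const x c) s 1 (s.setReg x c)
  | copy (s : RAMState) (x y : ℕ) : Runs (.copy x y) s 1 (s.setReg x (s.reg y))
  | add (s : RAMState) (x y z : ℕ) : Runs (.add x y z) s 1 (s.setReg x (s.reg y + s.reg z))
  | sub (s : RAMState) (x y z : ℕ) : Runs (.sub x y z) s 1 (s.setReg x (s.reg y - s.reg z))
  | load (s : RAMState) (x a y : ℕ) : Runs (.load x a y) s 1 (s.setReg x (s.arr a (s.reg y)))
  | store (s : RAMState) (a x y : ℕ) :
      Runs (.store a x y) s 1 (s.setArr a (s.reg x) (s.reg y))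
  | seq {p q : RAMProg} {s s' s'' : RAMState} {t t' : ℕ} :
      Runs p s t s' → Runs q s' t' s'' → Runs (.seq p q) s (t + t') s''
  | ifLt_true {x y : ℕ} {p q : RAMProg} {s s' : RAMState} {t : ℕ} :
      s.reg x < s.reg y → Runs p s t s' → Runs (.ifLt x y p q) s (t + 1) s'
  | ifLt_false {x y : ℕ} {p q : RAMProg} {s s' : RAMState} {t : ℕ} :
      ¬ s.reg x < s.reg y → Runs q s t s' → Runs (.ifLt x y p q) s (t + 1) s'
  | while_true {x y : ℕ} {p : RAMProg} {s s' s'' : RAMState} {t t' : ℕ} :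
      s.reg x < s.reg y → Runs p s t s' → Runs (.whileLt x y p) s' t' s'' →
        Runs (.whileLt x y p) s (t + t' + 1) s''
  | while_false {x y : ℕ} {p : RAMProg} {s : RAMState} :
      ¬ s.reg x < s.reg y → Runs (.whileLt x y p) s 1 s

/-! ### Inputs and outputs

Memory that does not hold the input is uninitialized: programs, those that compute dissatisfaction
functions and those that find assignments alike, have to work whatever it contains. -/

/-- The program `p` computes the family `α` in time `T`: given `m` in register `0` and `i ∈ [m]` in
register `1`, it halts within `T m` steps with `α m i` in register `0`. -/
def RAMProg.ComputesFamily (p : RAMProg) (α : ℕ → ℕ → ℕ) (T : ℕ → ℕ) : Prop :=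
  ∀ m i : ℕ, 1 ≤ i → i ≤ m → ∀ s : RAMState, s.reg 0 = m → s.reg 1 = i →
    ∃ (t : ℕ) (s' : RAMState), p.Runs s t s' ∧ t ≤ T m ∧ s'.reg 0 = α m i

/-- The state `s` holds the election `E` and the parliament size `k`: the registers `0`, `1`, `2`
hold `n`, `m`, `k`, and array `0` lists the preference orders of the voters one after the other,
each from the most desirable to the least desirable candidate. -/
def RAMState.HoldsInput {n m : ℕ} (s : RAMState) (E : Election n m) (k : ℕ) : Prop :=
  s.reg 0 = n ∧ s.reg 1 = m ∧ s.reg 2 = k ∧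
    ∀ (v : Fin n) (r : Fin m), s.arr 0 ((v : ℕ) * m + (r : ℕ)) = (E.ranking v r : ℕ)

/-- Array `1` of the state `s` holds the values `α 1, …, α m`. -/
def RAMState.HoldsTable (s : RAMState) (m : ℕ) (α : ℕ → ℕ) : Prop :=
  ∀ i : ℕ, 1 ≤ i → i ≤ m → s.arr 1 i = α i

/-- Array `2` of the state `s` holds the assignment `Φ`. -/
def RAMState.HoldsAssignment {n m : ℕ} (s : RAMState) (Φ : Fin n → Fin m) : Prop :=
  ∀ v : Fin n, s.arr 2 (v : ℕ) = (Φ v : ℕ)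

/-- Started in the state `s`, the program `p` finds within `B` steps an optimal `k`-Monroe
assignment for `E` under `α`-`ℓ_∞`-Monroe, and the one it finds has the contiguous blocks
property. -/
def RAMProg.FindsOptimalMonroe {n m : ℕ} (p : RAMProg) (s : RAMState) (B : ℕ)
    (E : Election n m) (α : ℕ → ℕ) (k : ℕ) : Prop :=
  ∃ (t : ℕ) (s' : RAMState) (Φ : Fin n → Fin m), p.Runs s t s' ∧ t ≤ B ∧
    s'.HoldsAssignment Φ ∧ E.IsOptimalMonroe α k Φ ∧ HasContiguousBlocks Φ

/-! ### Single-crossing narcissistic elections -/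

namespace Election

variable {n m : ℕ} {E : Election n m}

/-! Take the order of the first voter as an axis. For p < p' on it, the voters who prefer p form an
initial segment. As every candidate is on top for some voter, each voter is single-peaked along the
axis (`Election.SingleCrossing.single_peaked`). Hence the position of a fixed candidate, as a
function of the voter, is bounded on every interval of voters by the larger of its two end values
(`Election.SingleCrossing.axisPos_le_max`).

This has two consequences. Sorting a Monroe assignment along the axis keeps the number of voters of
each candidate and does not worsen the worst position (`Election.SingleCrossing.axisPos_sort_le`),
so some optimum consists of contiguous blocks whose candidates increase along the axis. And the cost
of a block is attained at its first or last voter, so a dynamic program can price a block in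
constant time.

Blocks have size ⌊n/k⌋ or ⌈n/k⌉ only. A table indexed by candidates allowed, blocks used and voters
covered therefore has constant-time transitions. Its values below infinity are realized
(`isBlockAssignment_blockAssign`) and bound every block assignment from below
(`IsBlockAssignment.blockTable_le`).

The rest verifies a machine program that fills the table and traces it back. It takes O(nmk) steps,
which is within the claimed bound. For a family of dissatisfaction functions, a renamed copy of the
given program first tabulates the values (`RAMProg.tabulate_haltsIn`). -/

theorem pos_injective (E : Election n m) (v : Fin n) : Function.Injective (E.pos v) := by
  intro a b h
  simpa [pos, Fin.val_inj] using h

theorem pos_ranking (E : Election n m) (v : Fin n) (r : Fin m) :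
    E.pos v (E.ranking v r) = r + 1 := by
  simp [pos]

theorem one_le_pos (E : Election n m) (v : Fin n) (c : Fin m) : 1 ≤ E.pos v c :=
  Nat.le_add_left _ _

theorem pos_le (E : Election n m) (v : Fin n) (c : Fin m) : E.pos v c ≤ m :=
  ((E.ranking v).symm c).isLt

theorem card_pos_lt (E : Election n m) (v : Fin n) (c : Fin m) :
    (Finset.univ.filter fun x => E.pos v x < E.pos v c).card = E.pos v c - 1 := by
  have h : (Finset.univ.filter fun x => E.pos v x < E.pos v c) =
      (Finset.Iio ((E.ranking v).symm c)).map (E.ranking v).toEmbedding := by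
    ext x
    simp [pos, Finset.mem_map_equiv]
  rw [h, Finset.card_map, Fin.card_Iio]
  simp [pos]

/-- A candidate that falls back from one voter to another is overtaken by some candidate. -/
theorem exists_overtaking {u v : Fin n} {c : Fin m} (h : E.pos u c < E.pos v c) :
    ∃ x, E.pos v x < E.pos v c ∧ E.pos u c < E.pos u x := by
  have hcard : (Finset.univ.filter fun x => E.pos u x < E.pos u c).card <
      (Finset.univ.filter fun x => E.pos v x < E.pos v c).card := by
    rw [card_pos_lt, card_pos_lt]
    have := E.one_le_pos u c
    omega
  obtain ⟨x, hx, hx'⟩ := Finset.exists_mem_notMem_of_card_lt_card hcard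
  simp only [Finset.mem_filter, Finset.mem_univ, true_and, not_lt] at hx hx'
  refine ⟨x, hx, lt_of_le_of_ne hx' fun he => ?_⟩
  rw [E.pos_injective u he] at hx
  exact lt_irrefl _ hx

/-- The position for voter `v` of the candidate with index `p` in the order of the first voter. -/
def axisPos (E : Election n m) (hn : 0 < n) (v : Fin n) (p : Fin m) : ℕ :=
  E.pos v (E.ranking ⟨0, hn⟩ p)

/-- A smaller index means preferred by the first voter, so single-crossing makes the supporters of p
against p' an initial segment. -/
theorem SingleCrossing.axisPos_lt (hE : E.SingleCrossing) (hn : 0 < n) {p p' : Fin m}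
    (hp : p < p') {u v : Fin n} (huv : u ≤ v) (h : E.axisPos hn v p < E.axisPos hn v p') :
    E.axisPos hn u p < E.axisPos hn u p' := by
  obtain ⟨t, -, -, ht⟩ := hE hn (E.ranking ⟨0, hn⟩ p) (E.ranking ⟨0, hn⟩ p')
    (by simpa [Prefers, pos_ranking] using hp)
  exact (ht u).2 (lt_of_le_of_lt huv ((ht v).1 h))

theorem axisPos_ne (hn : 0 < n) {p p' : Fin m} (hp : p ≠ p') (v : Fin n) :
    E.axisPos hn v p ≠ E.axisPos hn v p' := fun h =>
  hp ((E.ranking ⟨0, hn⟩).injective (E.pos_injective v h))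

/-- Compare v with a voter z who ranks p' first. If v comes before z, the preference of z for p'
over p'' passes back to v. If v comes after z, the preference of v for p over p' would pass back to
z. -/
theorem SingleCrossing.single_peaked (hE : E.SingleCrossing) (hN : E.Narcissistic) (hn : 0 < n)
    {p p' p'' : Fin m} (hp : p < p') (hp' : p' < p'') (v : Fin n)
    (h : E.axisPos hn v p < E.axisPos hn v p') : E.axisPos hn v p' < E.axisPos hn v p'' := by
  obtain ⟨z, hz⟩ := hN (E.ranking ⟨0, hn⟩ p')
  have top : ∀ x, x ≠ p' → E.axisPos hn z p' < E.axisPos hn z x := fun x hx =>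
    lt_of_le_of_ne (hz.le.trans (E.one_le_pos _ _)) (axisPos_ne hn hx.symm z)
  rcases le_total v z with hvz | hzv
  · exact hE.axisPos_lt hn hp' hvz (top _ hp'.ne')
  · exact absurd (hE.axisPos_lt hn hp hzv h) (top _ hp.ne).not_gt

theorem exists_axis_overtaking (hn : 0 < n) {u v : Fin n} {p : Fin m}
    (h : E.axisPos hn u p < E.axisPos hn v p) :
    ∃ x, E.axisPos hn v x < E.axisPos hn v p ∧ E.axisPos hn u p < E.axisPos hn u x := by
  obtain ⟨x, hx⟩ := exists_overtaking h
  exact ⟨(E.ranking ⟨0, hn⟩).symm x, by simpa [axisPos] using hx⟩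

/-- A candidate that is overtaken between `u` and a later voter `v` is overtaken by one that is
larger on the axis. -/
theorem SingleCrossing.exists_gt (hE : E.SingleCrossing) (hn : 0 < n) {u v : Fin n} (huv : u ≤ v)
    {p : Fin m} (h : E.axisPos hn u p < E.axisPos hn v p) :
    ∃ x, p < x ∧ E.axisPos hn v x < E.axisPos hn v p := by
  obtain ⟨x, hx, hx'⟩ := exists_axis_overtaking hn h
  refine ⟨x, lt_of_not_ge fun hxp => ?_, hx⟩
  rcases hxp.lt_or_eq with hlt | rfl
  · exact hx'.not_gt (hE.axisPos_lt hn hlt huv hx)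
  · exact lt_irrefl _ hx

theorem SingleCrossing.exists_lt (hE : E.SingleCrossing) (hn : 0 < n) {u v : Fin n} (huv : u ≤ v)
    {p : Fin m} (h : E.axisPos hn v p < E.axisPos hn u p) :
    ∃ x, x < p ∧ E.axisPos hn u x < E.axisPos hn u p := by
  obtain ⟨x, hx, hx'⟩ := exists_axis_overtaking hn h
  refine ⟨x, lt_of_not_ge fun hxp => ?_, hx⟩
  rcases hxp.lt_or_eq with hlt | rfl
  · exact hx.not_gt (hE.axisPos_lt hn hlt huv hx')
  · exact lt_irrefl _ hx

/-- Each candidate is liked least at the ends of a block of voters. -/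
theorem SingleCrossing.axisPos_le_max (hE : E.SingleCrossing) (hN : E.Narcissistic) (hn : 0 < n)
    {u v x : Fin n} (huv : u ≤ v) (hvx : v ≤ x) (p : Fin m) :
    E.axisPos hn v p ≤ max (E.axisPos hn u p) (E.axisPos hn x p) := by
  by_contra h
  rw [not_le, max_lt_iff] at h
  obtain ⟨y, hy, hy'⟩ := hE.exists_gt hn huv h.1
  obtain ⟨z, hz, hz'⟩ := hE.exists_lt hn hvx h.2
  exact hy'.not_gt (hE.single_peaked hN hn hz hy v hz')

/-- If p is ranked better by the later voter v, it has overtaken a candidate to its left. So u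
prefers something left of p to p, and by single-peakedness everything to the right of p is worse
still for u. -/
theorem SingleCrossing.axisPos_le_max_left (hE : E.SingleCrossing) (hN : E.Narcissistic)
    (hn : 0 < n) {u v : Fin n} (huv : u ≤ v) {p p' : Fin m} (hp : p ≤ p') :
    E.axisPos hn u p ≤ max (E.axisPos hn u p') (E.axisPos hn v p) := by
  rcases hp.eq_or_lt with rfl | hp
  · exact le_max_left _ _
  by_contra h
  rw [not_le, max_lt_iff] at h
  obtain ⟨z, hz, hz'⟩ := hE.exists_lt hn huv h.2
  exact h.1.not_gt (hE.single_peaked hN hn hz hp u hz')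

theorem SingleCrossing.axisPos_le_max_right (hE : E.SingleCrossing) (hN : E.Narcissistic)
    (hn : 0 < n) {u v : Fin n} (huv : u ≤ v) {p p' : Fin m} (hp : p ≤ p') :
    E.axisPos hn v p' ≤ max (E.axisPos hn v p) (E.axisPos hn u p') := by
  rcases hp.eq_or_lt with rfl | hp
  · exact le_max_left _ _
  by_contra h
  rw [not_le, max_lt_iff] at h
  obtain ⟨y, hy, hy'⟩ := hE.exists_gt hn huv h.2
  exact hy'.not_gt (hE.single_peaked hN hn hp hy v h.1)

end Election

/-! ### Sorting an assignment along the axis -/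

/-- Pigeonhole: otherwise all voters up to and including v have values below `g (τ v)`, so they
occupy sorted places strictly before v, and there is one place too few. -/
theorem exists_le_of_monotone_comp {n m : ℕ} {g : Fin n → Fin m} {τ : Equiv.Perm (Fin n)}
    (hτ : Monotone (g ∘ τ)) (v : Fin n) : ∃ u ≤ v, g (τ v) ≤ g u := by
  by_contra! h
  have hsub : Finset.Iic v ⊆ (Finset.Iio v).map τ.toEmbedding := by
    intro u hu
    rw [Finset.mem_map_equiv, Finset.mem_Iio]
    by_contra! hc
    have h1 := hτ hc
    simp only [Function.comp_apply, Equiv.apply_symm_apply] at h1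
    exact (h u (Finset.mem_Iic.1 hu)).not_ge h1
  have := Finset.card_le_card hsub
  rw [Finset.card_map, Fin.card_Iio, Fin.card_Iic] at this
  omega

theorem exists_ge_of_monotone_comp {n m : ℕ} {g : Fin n → Fin m} {τ : Equiv.Perm (Fin n)}
    (hτ : Monotone (g ∘ τ)) (v : Fin n) : ∃ u ≥ v, g u ≤ g (τ v) := by
  by_contra! h
  have hsub : Finset.Ici v ⊆ (Finset.Ioi v).map τ.toEmbedding := by
    intro u hu
    rw [Finset.mem_map_equiv, Finset.mem_Ioi]
    by_contra! hc
    have h1 := hτ hc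
    simp only [Function.comp_apply, Equiv.apply_symm_apply] at h1
    exact (h u (Finset.mem_Ici.1 hu)).not_ge h1
  have := Finset.card_le_card hsub
  rw [Finset.card_map, Fin.card_Ioi, Fin.card_Ici] at this
  omega

/-- Sorting an assignment along the axis does not make the worst position worse. -/
theorem Election.SingleCrossing.axisPos_sort_le {n m : ℕ} {E : Election n m}
    (hE : E.SingleCrossing) (hN : E.Narcissistic) (hn : 0 < n) {g : Fin n → Fin m}
    {τ : Equiv.Perm (Fin n)} (hτ : Monotone (g ∘ τ)) (v : Fin n) :
    ∃ u, E.axisPos hn v (g (τ v)) ≤ E.axisPos hn u (g u) := by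
  rcases le_total v (τ v) with hv | hv
  -- The candidate `g (τ v)` moves from `τ v` to the earlier voter v, while some u ≤ v originally
  -- had a candidate at or to the right of it. The position at v is bounded by those at u and `τ v`,
  -- and the one at u by the original positions of u and `τ v`.
  · obtain ⟨u, huv, hu⟩ := exists_le_of_monotone_comp hτ v
    have h1 := hE.axisPos_le_max_left hN hn (huv.trans hv) hu
    have h2 := hE.axisPos_le_max hN hn huv hv (g (τ v))
    rcases le_total (E.axisPos hn u (g u)) (E.axisPos hn (τ v) (g (τ v))) with h | h
    · exact ⟨τ v, h2.trans (max_le (h1.trans (max_le h le_rfl)) le_rfl)⟩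
    · exact ⟨u, h2.trans (max_le (h1.trans (max_le le_rfl h)) h)⟩
  · obtain ⟨u, huv, hu⟩ := exists_ge_of_monotone_comp hτ v
    have h1 := hE.axisPos_le_max_right hN hn (hv.trans huv) hu
    have h2 := hE.axisPos_le_max hN hn hv huv (g (τ v))
    rcases le_total (E.axisPos hn u (g u)) (E.axisPos hn (τ v) (g (τ v))) with h | h
    · exact ⟨τ v, h2.trans (max_le le_rfl (h1.trans (max_le h le_rfl)))⟩
    · exact ⟨u, h2.trans (max_le h (h1.trans (max_le le_rfl h)))⟩

/-! ### The dynamic program -/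

/-- Improve the pair `b` of a value and a block size, if possible, by a last block of `s` of the
first `i` voters, which is represented by `c`, where `D` is the value for the voters before it. -/
def improve (w : ℕ → ℕ → ℕ) (c i s : ℕ) (D : ℕ → ℕ) (b : ℕ × ℕ) : ℕ × ℕ :=
  if i < s then b
  else if max (max (D (i - s)) (w (i - s) c)) (w (i - 1) c) < b.1 then
    (max (max (D (i - s)) (w (i - s) c)) (w (i - 1) c), s)
  else b

/-- `blockTable w inf q q' c j i` consists of the optimal value for the first `i` voters, to be
cut into `j` blocks of size `q` or `q'` and represented by `j` of the first `c` candidates,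
and of the size of the block of the last of these candidates in an optimal solution. -/
def blockTable (w : ℕ → ℕ → ℕ) (inf q q' : ℕ) : ℕ → ℕ → ℕ → ℕ × ℕ
  | 0, j, i => (if j = 0 ∧ i = 0 then 0 else inf, 0)
  | c + 1, j, i =>
    if 0 < j then
      improve w c i q' (fun i => (blockTable w inf q q' c (j - 1) i).1)
        (improve w c i q (fun i => (blockTable w inf q q' c (j - 1) i).1)
          ((blockTable w inf q q' c j i).1, 0))
    else ((blockTable w inf q q' c j i).1, 0)

/-- The assignment read off from `blockTable`. -/
def blockAssign (w : ℕ → ℕ → ℕ) (inf q q' : ℕ) : ℕ → ℕ → ℕ → ℕ → ℕ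
  | 0, _, _, _ => 0
  | c + 1, j, i, v =>
    if i - (blockTable w inf q q' (c + 1) j i).2 ≤ v then c
    else blockAssign w inf q q' c
      (if (blockTable w inf q q' (c + 1) j i).2 = 0 then j else j - 1)
      (i - (blockTable w inf q q' (c + 1) j i).2) v

/-! ### The table of the dynamic program: realizability and lower bound -/

section BlockTable

variable {w : ℕ → ℕ → ℕ} {inf q q' : ℕ}

theorem improve_fst_le (c i s : ℕ) (D : ℕ → ℕ) (b : ℕ × ℕ) :
    (improve w c i s D b).1 ≤ b.1 := by
  unfold improve
  split_ifs <;> simp_all [le_of_lt]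

theorem improve_fst_le_max {c i s : ℕ} (D : ℕ → ℕ) (b : ℕ × ℕ) (hs : s ≤ i) :
    (improve w c i s D b).1 ≤ max (max (D (i - s)) (w (i - s) c)) (w (i - 1) c) := by
  unfold improve
  rw [if_neg hs.not_gt]
  split_ifs with h
  · exact le_rfl
  · exact not_lt.1 h

theorem improve_eq_or (c i s : ℕ) (D : ℕ → ℕ) (b : ℕ × ℕ) : improve w c i s D b = b ∨
    s ≤ i ∧ improve w c i s D b =
      (max (max (D (i - s)) (w (i - s) c)) (w (i - 1) c), s) := by
  unfold improve
  split_ifs with h h'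
  · exact .inl rfl
  · exact .inr ⟨not_lt.1 h, rfl⟩
  · exact .inl rfl

theorem blockTable_succ_le (c j i : ℕ) :
    (blockTable w inf q q' (c + 1) j i).1 ≤ (blockTable w inf q q' c j i).1 := by
  rw [blockTable]
  split_ifs
  · exact (improve_fst_le _ _ _ _ _).trans (improve_fst_le _ _ _ _ _)
  · exact le_rfl

theorem blockTable_succ_succ_le {c j i s : ℕ} (hs : s = q ∨ s = q') (hsi : s ≤ i) :
    (blockTable w inf q q' (c + 1) (j + 1) i).1 ≤
      max (max (blockTable w inf q q' c j (i - s)).1 (w (i - s) c)) (w (i - 1) c) := by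
  rw [blockTable, if_pos j.succ_pos, Nat.add_sub_cancel]
  rcases hs with rfl | rfl
  · exact (improve_fst_le _ _ _ _ _).trans (improve_fst_le_max _ _ hsi)
  · exact improve_fst_le_max _ _ hsi

/-- The recorded block size is `0`, or it is the size of a block that realizes the value. -/
theorem blockTable_succ_cases (c j i : ℕ) :
    blockTable w inf q q' (c + 1) j i = ((blockTable w inf q q' c j i).1, 0) ∨
    ∃ s, (s = q ∨ s = q') ∧ 0 < j ∧ s ≤ i ∧ blockTable w inf q q' (c + 1) j i =
      (max (max (blockTable w inf q q' c (j - 1) (i - s)).1 (w (i - s) c)) (w (i - 1) c), s) := by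
  rw [blockTable]
  split_ifs with hj
  · rcases improve_eq_or (w := w) c i q' (fun i => (blockTable w inf q q' c (j - 1) i).1)
        (improve w c i q (fun i => (blockTable w inf q q' c (j - 1) i).1)
          ((blockTable w inf q q' c j i).1, 0)) with h | ⟨hs, h⟩
    · rw [h]
      rcases improve_eq_or (w := w) c i q (fun i => (blockTable w inf q q' c (j - 1) i).1)
          ((blockTable w inf q q' c j i).1, 0) with h | ⟨hs, h⟩
      · exact .inl h
      · exact .inr ⟨q, .inl rfl, hj, hs, h⟩
    · exact .inr ⟨q', .inr rfl, hj, hs, h⟩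
  · exact .inl rfl

theorem blockTable_snd_le (c j i : ℕ) : (blockTable w inf q q' (c + 1) j i).2 ≤ i := by
  rcases blockTable_succ_cases (w := w) (inf := inf) (q := q) (q' := q') c j i with
    h | ⟨s, -, -, hs, h⟩ <;> rw [h]
  · exact Nat.zero_le _
  · exact hs

theorem pos_of_blockTable_snd_ne_zero {c j i : ℕ}
    (h0 : (blockTable w inf q q' (c + 1) j i).2 ≠ 0) : 0 < j := by
  rcases blockTable_succ_cases (w := w) (inf := inf) (q := q) (q' := q') c j i with
    h | ⟨s, -, hj, -, h⟩
  · simp [h] at h0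
  · exact hj

/-- Tracing back along the recorded sizes never increases the value, so a trace that starts below
`inf` stays there and ends at the empty entry. -/
theorem blockTable_pred_le (hq : 1 ≤ q) (hq' : 1 ≤ q') (c j i : ℕ) :
    (blockTable w inf q q' c
      (if (blockTable w inf q q' (c + 1) j i).2 = 0 then j else j - 1)
      (i - (blockTable w inf q q' (c + 1) j i).2)).1 ≤ (blockTable w inf q q' (c + 1) j i).1 := by
  rcases blockTable_succ_cases (w := w) (inf := inf) (q := q) (q' := q') c j i with
    h | ⟨s, hs, -, -, h⟩ <;> rw [h]
  · simp
  -- Block sizes are positive, so the recorded size 0 can only mean that the candidate is not used.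
  · rw [if_neg (by rcases hs with rfl | rfl <;> simp only <;> omega)]
    exact (le_max_left _ _).trans (le_max_left _ _)

theorem eq_zero_of_blockTable_zero_lt {j i : ℕ} (h : (blockTable w inf q q' 0 j i).1 < inf) :
    j = 0 ∧ i = 0 := by
  by_contra hc
  simp [blockTable, if_neg hc] at h

/-- The properties of an assignment `g` of the voters below `i` to `j` of the candidates below `c`
in increasing blocks of size `q` or `q'` at costs of at most `d`. -/
structure IsBlockAssignment (w : ℕ → ℕ → ℕ) (q q' c j i d : ℕ) (g : ℕ → ℕ) : Prop where
  lt : ∀ v < i, g v < c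
  mono : ∀ u v, u ≤ v → v < i → g u ≤ g v
  card_image : ((Finset.range i).image g).card = j
  card_fiber : ∀ p, ((Finset.range i).filter fun v => g v = p).card = 0 ∨
    ((Finset.range i).filter fun v => g v = p).card = q ∨
    ((Finset.range i).filter fun v => g v = p).card = q'
  cost_le : ∀ v < i, w v (g v) ≤ d

/-- All earlier candidates lie below c, so the appended block is a new fiber and monotonicity
persists. -/
theorem IsBlockAssignment.snoc {c j i d s : ℕ} {g g' : ℕ → ℕ}
    (hg : IsBlockAssignment w q q' c j i d g) (hs : s = q ∨ s = q') (hs0 : 0 < s)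
    (hlt : ∀ v < i, g' v = g v) (hge : ∀ v, i ≤ v → v < i + s → g' v = c)
    {d' : ℕ} (hd : d ≤ d') (hcost : ∀ v, i ≤ v → v < i + s → w v c ≤ d') :
    IsBlockAssignment w q q' (c + 1) (j + 1) (i + s) d' g' := by
  have himg : (Finset.range (i + s)).image g' = insert c ((Finset.range i).image g) := by
    ext p
    simp only [Finset.mem_image, Finset.mem_range, Finset.mem_insert]
    constructor
    · rintro ⟨v, hv, rfl⟩
      rcases lt_or_ge v i with h | h
      · exact .inr ⟨v, h, (hlt v h).symm⟩
      · exact .inl (hge v h hv)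
    · rintro (rfl | ⟨v, hv, rfl⟩)
      · exact ⟨i, by omega, hge i le_rfl (by omega)⟩
      · exact ⟨v, by omega, hlt v hv⟩
  refine ⟨fun v hv => ?_, fun u v huv hv => ?_, ?_, fun p => ?_, fun v hv => ?_⟩
  · rcases lt_or_ge v i with h | h
    · rw [hlt v h]; exact (hg.lt v h).trans (Nat.lt_succ_self c)
    · rw [hge v h hv]; exact Nat.lt_succ_self c
  · rcases lt_or_ge v i with h | h
    · rw [hlt v h, hlt u (by omega)]; exact hg.mono u v huv h
    · rw [hge v h hv]
      rcases lt_or_ge u i with h' | h'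
      · rw [hlt u h']; exact (hg.lt u h').le
      · rw [hge u h' (by omega)]
  · rw [himg, Finset.card_insert_of_notMem, hg.card_image]
    simp only [Finset.mem_image, Finset.mem_range, not_exists, not_and]
    exact fun v hv => (hg.lt v hv).ne
  · by_cases hp : p = c
    · have : ((Finset.range (i + s)).filter fun v => g' v = p) = Finset.Ico i (i + s) := by
        ext v
        simp only [Finset.mem_filter, Finset.mem_range, Finset.mem_Ico, hp]
        constructor
        · rintro ⟨hv, h⟩
          refine ⟨le_of_not_gt fun hvi => ?_, hv⟩
          rw [hlt v hvi] at h
          exact (hg.lt v hvi).ne h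
        · rintro ⟨h, hv⟩
          exact ⟨hv, hge v h hv⟩
      rw [this, Nat.card_Ico, Nat.add_sub_cancel_left]
      exact .inr hs
    · have : ((Finset.range (i + s)).filter fun v => g' v = p) =
          (Finset.range i).filter fun v => g v = p := by
        ext v
        simp only [Finset.mem_filter, Finset.mem_range]
        constructor
        · rintro ⟨hv, h⟩
          have hvi : v < i := lt_of_not_ge fun hvi => hp (h ▸ (hge v hvi hv))
          exact ⟨hvi, hlt v hvi ▸ h⟩
        · rintro ⟨hv, h⟩
          exact ⟨by omega, (hlt v hv).trans h⟩
      rw [this]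
      exact hg.card_fiber p
  · rcases lt_or_ge v i with h | h
    · rw [hlt v h]; exact (hg.cost_le v h).trans hd
    · rw [hge v h hv]; exact hcost v h hv

/-- The recursion charges a block only at its first and last voter; `hw` extends the bound to the
voters between them. Entries with value `inf` are excluded because they need not come from any
assignment. -/
theorem isBlockAssignment_blockAssign {n m : ℕ} (hq : 1 ≤ q) (hq' : 1 ≤ q')
    (hw : ∀ p < m, ∀ u v x, u ≤ v → v ≤ x → x < n → w v p ≤ max (w u p) (w x p)) :
    ∀ c ≤ m, ∀ j, ∀ i ≤ n, (blockTable w inf q q' c j i).1 < inf →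
      IsBlockAssignment w q q' c j i (blockTable w inf q q' c j i).1
        (blockAssign w inf q q' c j i)
  | 0, _, j, i, _, h => by
    obtain ⟨rfl, rfl⟩ := eq_zero_of_blockTable_zero_lt h
    exact ⟨by simp, by simp, by simp, by simp, by simp⟩
  | c + 1, hc, j, i, hi, h => by
    have ih := isBlockAssignment_blockAssign hq hq' hw c (by omega)
    rcases blockTable_succ_cases (w := w) (inf := inf) (q := q) (q' := q') c j i with
      hs | ⟨s, hs, hj, hsi, hT⟩
    · have hg := ih j i hi (by rw [hs] at h; exact h)
      have heq : ∀ v < i, blockAssign w inf q q' (c + 1) j i v =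
          blockAssign w inf q q' c j i v := fun v hv => by
        rw [blockAssign, hs]
        simp [hv]
      have himg : (Finset.range i).image (blockAssign w inf q q' (c + 1) j i) =
          (Finset.range i).image (blockAssign w inf q q' c j i) :=
        Finset.image_congr fun v hv => heq v (by simpa using hv)
      have hfib : ∀ p, ((Finset.range i).filter fun v => blockAssign w inf q q' (c + 1) j i v = p) =
          (Finset.range i).filter fun v => blockAssign w inf q q' c j i v = p := fun p =>
        Finset.filter_congr fun v hv => by rw [heq v (Finset.mem_range.1 hv)]
      rw [hs]
      refine ⟨fun v hv => ?_, fun u v huv hv => ?_, ?_, fun p => ?_, fun v hv => ?_⟩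
      · rw [heq v hv]; exact (hg.lt v hv).trans (Nat.lt_succ_self c)
      · rw [heq v hv, heq u (by omega)]; exact hg.mono u v huv hv
      · rw [himg]; exact hg.card_image
      · rw [hfib]; exact hg.card_fiber p
      · rw [heq v hv]; exact hg.cost_le v hv
    · have hs0 : 0 < s := by rcases hs with rfl | rfl <;> omega
      obtain ⟨j, rfl⟩ := Nat.exists_eq_add_of_lt hj
      obtain ⟨i, rfl⟩ := Nat.exists_eq_add_of_le' hsi
      rw [zero_add] at *
      rw [Nat.add_sub_cancel, Nat.add_sub_cancel] at hT
      have hle : (blockTable w inf q q' c j i).1 ≤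
          (blockTable w inf q q' (c + 1) (j + 1) (i + s)).1 := by
        rw [hT]; exact (le_max_left _ _).trans (le_max_left _ _)
      refine (ih j i (by omega) (hle.trans_lt h)).snoc hs hs0 (fun v hv => ?_)
        (fun v hv hv' => ?_) hle (fun v hv hv' => ?_)
      · rw [blockAssign, hT]
        simp only [Nat.add_sub_cancel, if_neg hv.not_ge, if_neg hs0.ne']
      · rw [blockAssign, hT]
        simp [hv]
      · rw [hT]
        refine (hw c (by omega) i v (i + s - 1) hv (by omega) (by omega)).trans ?_
        exact max_le ((le_max_right _ _).trans (le_max_left _ _)) (le_max_right _ _)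

theorem mem_iff_lt_card_of_lower {S : Finset ℕ} (hS : ∀ v ∈ S, ∀ u ≤ v, u ∈ S) (v : ℕ) :
    v ∈ S ↔ v < S.card := by
  constructor
  · intro hv
    have : Finset.range (v + 1) ⊆ S := fun u hu =>
      hS v hv u (Nat.lt_succ_iff.1 (Finset.mem_range.1 hu))
    simpa using Finset.card_le_card this
  · intro hv
    by_contra hc
    have : S ⊆ Finset.range v := fun u hu => by
      rw [Finset.mem_range]
      by_contra! h
      exact hc (hS u hu v h)
    have := Finset.card_le_card this
    rw [Finset.card_range] at this
    omega

/-- The value of `blockTable` is a lower bound for the costs of block assignments. -/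
theorem IsBlockAssignment.blockTable_le {m k n d : ℕ} {g : ℕ → ℕ}
    (hg : IsBlockAssignment w q q' m k n d g) : (blockTable w inf q q' m k n).1 ≤ d := by
  -- Cut g at a threshold c. By monotonicity the voters assigned below c form an initial segment, so
  -- this part of g competes for one entry of the table, and raising c by one appends at most one
  -- block.
  have key : ∀ c, (blockTable w inf q q' c
      (((Finset.range n).filter fun v => g v < c).image g).card
      ((Finset.range n).filter fun v => g v < c).card).1 ≤ d := by
    intro c
    induction c with
    | zero => simp [blockTable]
    | succ c ih =>
      have hlow : ∀ c, ∀ v, v ∈ ((Finset.range n).filter fun v => g v < c) ↔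
          v < ((Finset.range n).filter fun v => g v < c).card := fun c => by
        apply mem_iff_lt_card_of_lower
        intro v hv u huv
        simp only [Finset.mem_filter, Finset.mem_range] at hv ⊢
        exact ⟨by omega, (hg.mono u v huv hv.1).trans_lt hv.2⟩
      have hsplit : ((Finset.range n).filter fun v => g v < c + 1) =
          ((Finset.range n).filter fun v => g v < c) ∪
            (Finset.range n).filter fun v => g v = c := by
        ext v
        simp only [Finset.mem_filter, Finset.mem_union, Finset.mem_range]
        omega
      have hdisj : Disjoint ((Finset.range n).filter fun v => g v < c)
          ((Finset.range n).filter fun v => g v = c) := by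
        rw [Finset.disjoint_filter]
        omega
      have hcard := Finset.card_union_of_disjoint hdisj
      rw [← hsplit] at hcard
      have hlow' := hlow (c + 1)
      rcases hg.card_fiber c with h0 | hs
      · have : ((Finset.range n).filter fun v => g v < c + 1) =
            (Finset.range n).filter fun v => g v < c := by
          rw [hsplit, Finset.card_eq_zero.1 h0, Finset.union_empty]
        rw [this]
        exact (blockTable_succ_le _ _ _).trans ih
      -- Here q and q' may be 0, so a fiber of size q or q' can still be empty.
      · by_cases h0 : ((Finset.range n).filter fun v => g v = c).card = 0
        · have : ((Finset.range n).filter fun v => g v < c + 1) =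
              (Finset.range n).filter fun v => g v < c := by
            rw [hsplit, Finset.card_eq_zero.1 h0, Finset.union_empty]
          rw [this]
          exact (blockTable_succ_le _ _ _).trans ih
        have himg : (((Finset.range n).filter fun v => g v < c + 1).image g).card =
            (((Finset.range n).filter fun v => g v < c).image g).card + 1 := by
          have h1 : ((Finset.range n).filter fun v => g v = c).image g = {c} := by
            ext p
            simp only [Finset.mem_image, Finset.mem_filter, Finset.mem_range,
              Finset.mem_singleton]
            constructor
            · rintro ⟨v, ⟨-, h⟩, rfl⟩
              exact h
            · rintro rfl
              obtain ⟨v, hv⟩ := Finset.card_pos.1 (Nat.pos_of_ne_zero h0)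
              simp only [Finset.mem_filter, Finset.mem_range] at hv
              exact ⟨v, hv, hv.2⟩
          rw [hsplit, Finset.image_union, h1, Finset.card_union_of_disjoint, Finset.card_singleton]
          rw [Finset.disjoint_singleton_right]
          simp only [Finset.mem_image, Finset.mem_filter, not_exists, not_and]
          exact fun v hv => hv.2.ne
        set I := ((Finset.range n).filter fun v => g v < c).card
        set s := ((Finset.range n).filter fun v => g v = c).card
        -- The voters of c are the difference of two initial segments, hence exactly the interval
        -- from I to I + s.
        have hblock : ∀ v, I ≤ v → v < I + s → w v c ≤ d := by
          intro v hv hv'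
          rw [← hcard] at hv'
          have h1 := (hlow' v).2 hv'
          have h2 := mt (hlow c v).1 hv.not_gt
          simp only [Finset.mem_filter, Finset.mem_range, not_and, not_lt] at h1 h2
          have h3 : g v = c := le_antisymm (Nat.lt_succ_iff.1 h1.2) (h2 h1.1)
          exact h3 ▸ hg.cost_le v h1.1
        rw [himg, hcard]
        refine (blockTable_succ_succ_le hs (Nat.le_add_left s I)).trans ?_
        rw [Nat.add_sub_cancel]
        exact max_le (max_le ih (hblock _ le_rfl (by omega))) (hblock _ (by omega) (by omega))
  have hall : ((Finset.range n).filter fun v => g v < m) = Finset.range n :=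
    Finset.filter_true_of_mem fun v hv => hg.lt v (Finset.mem_range.1 hv)
  have := key m
  rwa [hall, hg.card_image, Finset.card_range] at this

end BlockTable

/-! ### Monroe assignments and block assignments -/

theorem card_filter_univ_fin (n : ℕ) (P : ℕ → Prop) [DecidablePred P] :
    (Finset.univ.filter fun v : Fin n => P v).card = ((Finset.range n).filter P).card := by
  rw [← Nat.Iio_eq_range, ← Fin.map_valEmbedding_univ, Finset.filter_map, Finset.card_map]
  rfl

theorem image_range_eq_image_univ {n : ℕ} (g : ℕ → ℕ) :
    (Finset.range n).image g = Finset.univ.image fun v : Fin n => g v := by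
  ext p
  simp only [Finset.mem_image, Finset.mem_range, Finset.mem_univ, true_and]
  exact ⟨fun ⟨v, hv, h⟩ => ⟨⟨v, hv⟩, h⟩, fun ⟨v, h⟩ => ⟨v, v.isLt, h⟩⟩

/-- This turns a fiber size between floor and ceiling into one of these two values, the only ones
the table tries. -/
theorem ceilDiv_le_div_add_one (n : ℕ) {k : ℕ} (hk : 1 ≤ k) : n ⌈/⌉ k ≤ n / k + 1 := by
  rw [Nat.ceilDiv_eq_add_pred_div, ← Nat.add_div_right n hk]
  exact Nat.div_le_div_right (by omega)

theorem div_le_ceilDiv (n : ℕ) (k : ℕ) : n / k ≤ n ⌈/⌉ k := by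
  rcases k.eq_zero_or_pos with rfl | hk
  · simp
  rw [Nat.ceilDiv_eq_add_pred_div]
  exact Nat.div_le_div_right (by omega)

/-- Distinct candidates are on top for distinct voters. With k ≤ m this gives k ≤ n, so all blocks
are nonempty. -/
theorem Election.Narcissistic.le {n m : ℕ} {E : Election n m} (hN : E.Narcissistic) : m ≤ n := by
  choose f hf using hN
  have : Function.Injective f := fun a b h => E.pos_injective (f a) (by rw [hf a, h, hf b])
  simpa using Fintype.card_le_of_injective f this

/-- Deal the voters out cyclically to the first k candidates: fibers are residue classes modulo k.
-/
theorem exists_isMonroeAssignment {n m k : ℕ} (hk : 1 ≤ k) (hkm : k ≤ m) (hkn : k ≤ n) :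
    ∃ Φ : Fin n → Fin m, IsMonroeAssignment k Φ := by
  have himg : (Finset.univ.image fun v : Fin n =>
      (⟨v % k, (Nat.mod_lt _ hk).trans_le hkm⟩ : Fin m)).card = k := by
    have : (Finset.univ.image fun v : Fin n =>
      (⟨v % k, (Nat.mod_lt _ hk).trans_le hkm⟩ : Fin m)) =
        Finset.univ.filter fun c : Fin m => (c : ℕ) < k := by
      ext c
      simp only [Finset.mem_image, Finset.mem_univ, true_and, Finset.mem_filter, Fin.ext_iff]
      constructor
      · rintro ⟨v, hv⟩
        rw [← hv]
        exact Nat.mod_lt _ hk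
      · exact fun hc => ⟨⟨c, hc.trans_le hkn⟩, Nat.mod_eq_of_lt hc⟩
    rw [this, card_filter_univ_fin m fun c => c < k]
    have : ((Finset.range m).filter fun c => c < k) = Finset.range k := by
      ext c
      simp only [Finset.mem_filter, Finset.mem_range]
      omega
    rw [this, Finset.card_range]
  refine ⟨fun v => ⟨v % k, (Nat.mod_lt _ hk).trans_le hkm⟩, himg.le, himg, fun c => ?_⟩
  simp only [Fin.ext_iff]
  rw [card_filter_univ_fin n fun v => v % k = c]
  rcases lt_or_ge (c : ℕ) k with hc | hc
  · right
    have h1 : ((Finset.range n).filter fun v => v % k = c).card =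
        n.count (· ≡ (c : ℕ) [MOD k]) := by
      rw [Nat.count_eq_card_filter_range]
      congr 1
      ext v
      simp [Nat.ModEq, Nat.mod_eq_of_lt hc]
    rw [h1, Nat.count_modEq_card _ hk]
    refine ⟨Nat.le_add_right _ _, ?_⟩
    split_ifs with h
    · rw [Nat.ceilDiv_eq_add_pred_div, ← Nat.add_div_right n hk]
      have h2 := Nat.div_add_mod n k
      -- Some residue lies below `n % k`, so the remainder is positive and the ceiling exceeds the
      -- floor.
      have h3 : k * (n / k) + k + ((n % k) - 1) = n + k - 1 := by omega
      rw [← h3, Nat.add_div_right n hk]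
      rw [Nat.le_div_iff_mul_le hk]
      have : (n / k + 1) * k = k * (n / k) + k := by ring
      omega
    · exact div_le_ceilDiv n k
  · left
    rw [Finset.card_eq_zero, Finset.filter_eq_empty_iff]
    intro v _ h
    have := Nat.mod_lt v hk
    omega

namespace Election

variable {n m k : ℕ} {E : Election n m} {a : ℕ → ℕ} {w : ℕ → ℕ → ℕ}

theorem linfty_le_iff (E : Election n m) (a : ℕ → ℕ) (Φ : Fin n → Fin m) (d : ℕ) :
    E.linfty a Φ ≤ d ↔ ∀ v, a (E.pos v (Φ v)) ≤ d := by
  simp [linfty]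

theorem _root_.IsDissatisfaction.pos_mono (ha : IsDissatisfaction m a) (E : Election n m)
    {u v : Fin n} {c d : Fin m} (h : E.pos u c ≤ E.pos v d) : a (E.pos u c) ≤ a (E.pos v d) :=
  ha.mono ⟨E.one_le_pos _ _, E.pos_le _ _⟩ ⟨E.one_le_pos _ _, E.pos_le _ _⟩ h

/-- Sorting a Monroe assignment along the axis gives a block assignment. -/
theorem SingleCrossing.exists_isBlockAssignment (hE : E.SingleCrossing) (hN : E.Narcissistic)
    (hn : 0 < n) (ha : IsDissatisfaction m a) (hk : 1 ≤ k)
    (hw : ∀ (v : Fin n) (p : Fin m), w v p = a (E.axisPos hn v p))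
    {Ψ : Fin n → Fin m} (hΨ : IsMonroeAssignment k Ψ) :
    ∃ g, IsBlockAssignment w (n / k) (n ⌈/⌉ k) m k n (E.linfty a Ψ) g := by
  set σ := E.ranking ⟨0, hn⟩ with hσ
  set g₀ : Fin n → Fin m := fun v => σ.symm (Ψ v) with hg₀
  set τ := Tuple.sort g₀
  have hτ : Monotone (g₀ ∘ τ) := Tuple.monotone_sort g₀
  have hg : ∀ v : Fin n, (fun v => if h : v < n then (g₀ (τ ⟨v, h⟩) : ℕ) else 0) v =
      (g₀ (τ v) : ℕ) := fun v => by simp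
  -- The value 0 beyond the last voter is a dummy; block assignments are only inspected below n.
  refine ⟨fun v => if h : v < n then (g₀ (τ ⟨v, h⟩) : ℕ) else 0, fun v hv => ?_,
    fun u v huv hv => ?_, ?_, fun p => ?_, fun v hv => ?_⟩
  · simp only [dif_pos hv, Fin.is_lt]
  · simp only [dif_pos hv, dif_pos (huv.trans_lt hv)]
    exact hτ (a := ⟨u, huv.trans_lt hv⟩) (b := ⟨v, hv⟩) huv
  · rw [image_range_eq_image_univ]
    simp only [hg]
    have : (Finset.univ.image fun v : Fin n => (g₀ (τ v) : ℕ)) =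
        ((Finset.univ.image Ψ).map σ.symm.toEmbedding).map Fin.valEmbedding := by
      ext p
      simp only [Finset.mem_image, Finset.mem_univ, true_and, Finset.mem_map]
      constructor
      · rintro ⟨v, rfl⟩
        exact ⟨_, ⟨_, ⟨τ v, rfl⟩, rfl⟩, rfl⟩
      · rintro ⟨_, ⟨_, ⟨v, rfl⟩, rfl⟩, rfl⟩
        exact ⟨τ.symm v, by simp [hg₀]⟩
    rw [this, Finset.card_map, Finset.card_map, hΨ.card_image]
  · rw [← card_filter_univ_fin n]
    simp only [hg]
    have h1 : (Finset.univ.filter fun v : Fin n => (g₀ (τ v) : ℕ) = p).card =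
        (Finset.univ.filter fun v : Fin n => (g₀ v : ℕ) = p).card :=
      Finset.card_equiv τ fun v => by simp
    rw [h1]
    rcases lt_or_ge p m with hp | hp
    · have h2 : (Finset.univ.filter fun v : Fin n => (g₀ v : ℕ) = p) =
          Finset.univ.filter fun v => Ψ v = σ ⟨p, hp⟩ := by
        ext v
        simp only [Finset.mem_filter, Finset.mem_univ, true_and, hg₀]
        rw [← Equiv.symm_apply_eq, Fin.ext_iff]
      rw [h2]
      have := ceilDiv_le_div_add_one n hk
      have := hΨ.card_fiber (σ ⟨p, hp⟩)
      omega
    · left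
      rw [Finset.card_eq_zero, Finset.filter_eq_empty_iff]
      intro v _ h
      have := (g₀ v).isLt
      omega
  · simp only [dif_pos hv]
    rw [hw ⟨v, hv⟩]
    obtain ⟨u, hu⟩ := hE.axisPos_sort_le hN hn hτ ⟨v, hv⟩
    refine (ha.pos_mono E hu).trans ?_
    simp only [hg₀, ← hσ, Equiv.apply_symm_apply]
    exact (E.linfty_le_iff a Ψ _).1 le_rfl u

theorem _root_.IsBlockAssignment.isMonroeAssignment {q q' d : ℕ} {g : ℕ → ℕ}
    (hg : IsBlockAssignment w q q' m k n d g) (hq : n / k ≤ q) (hqq' : q ≤ q')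
    (hq' : q' ≤ n ⌈/⌉ k) (σ : Fin m ≃ Fin m) :
    IsMonroeAssignment k fun v : Fin n => σ ⟨g v, hg.lt v v.isLt⟩ := by
  have himg : (Finset.univ.image fun v : Fin n => σ ⟨g v, hg.lt v v.isLt⟩).card = k := by
    have : ((Finset.univ.image fun v : Fin n => σ ⟨g v, hg.lt v v.isLt⟩).map
        σ.symm.toEmbedding).map Fin.valEmbedding = (Finset.range n).image g := by
      rw [image_range_eq_image_univ, Finset.map_eq_image, Finset.map_eq_image,
        Finset.image_image, Finset.image_image]
      congr 1
      ext v
      simp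
    refine Eq.trans ?_ hg.card_image
    rw [← this, Finset.card_map, Finset.card_map]
  refine ⟨himg.le, himg, fun c => ?_⟩
  have h : (Finset.univ.filter fun v : Fin n => σ ⟨g v, hg.lt v v.isLt⟩ = c).card =
      ((Finset.range n).filter fun v => g v = σ.symm c).card := by
    rw [← card_filter_univ_fin n]
    congr 1
    ext v
    simp only [Finset.mem_filter, Finset.mem_univ, true_and]
    rw [← Equiv.eq_symm_apply, Fin.ext_iff]
  rw [h]
  have := hg.card_fiber (σ.symm c)
  omega

theorem _root_.IsBlockAssignment.hasContiguousBlocks {q q' d : ℕ} {g : ℕ → ℕ}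
    (hg : IsBlockAssignment w q q' m k n d g) (σ : Fin m ≃ Fin m) :
    HasContiguousBlocks fun v : Fin n => σ ⟨g v, hg.lt v v.isLt⟩ := by
  intro u v x huv hvx h
  have h1 := hg.mono u v huv v.isLt
  have h2 := hg.mono v x hvx x.isLt
  have h3 : g u = g x := by simpa using h
  simp only [EmbeddingLike.apply_eq_iff_eq, Fin.mk.injEq]
  omega

/-- No dissatisfaction exceeds `a m`, so `a m + 1` can serve as infinity; a Monroe assignment
exists, so the final entry stays below it. -/
theorem blockTable_lt (hE : E.SingleCrossing) (hN : E.Narcissistic) (hn : 0 < n)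
    (ha : IsDissatisfaction m a) (hk : 1 ≤ k) (hkm : k ≤ m)
    (hw : ∀ (v : Fin n) (p : Fin m), w v p = a (E.axisPos hn v p)) :
    (blockTable w (a m + 1) (n / k) (n ⌈/⌉ k) m k n).1 < a m + 1 := by
  obtain ⟨Ψ, hΨ⟩ := exists_isMonroeAssignment (n := n) hk hkm (hkm.trans hN.le)
  obtain ⟨g, hg⟩ := hE.exists_isBlockAssignment hN hn ha hk hw hΨ
  refine Nat.lt_succ_of_le (hg.blockTable_le.trans ((E.linfty_le_iff a Ψ _).2 fun v => ?_))
  exact ha.mono ⟨E.one_le_pos _ _, E.pos_le _ _⟩ ⟨hk.trans hkm, le_rfl⟩ (E.pos_le _ _)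

/-- The assignment found by the dynamic program is optimal. -/
theorem exists_isOptimalMonroe_blockAssign (hE : E.SingleCrossing) (hN : E.Narcissistic)
    (hn : 0 < n) (ha : IsDissatisfaction m a) (hk : 1 ≤ k) (hkm : k ≤ m)
    (hw : ∀ (v : Fin n) (p : Fin m), w v p = a (E.axisPos hn v p)) :
    ∃ Φ : Fin n → Fin m, (∀ v : Fin n,
        ∃ h : blockAssign w (a m + 1) (n / k) (n ⌈/⌉ k) m k n v < m,
          Φ v = E.ranking ⟨0, hn⟩ ⟨_, h⟩) ∧
      E.IsOptimalMonroe a k Φ ∧ HasContiguousBlocks Φ := by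
  have hq : 1 ≤ n / k := (Nat.le_div_iff_mul_le hk).2 (by simpa using hkm.trans hN.le)
  have hq' := div_le_ceilDiv n k
  have hg := isBlockAssignment_blockAssign (w := w) (m := m) (n := n) hq (hq.trans hq')
    (fun p hp u v x huv hvx hx => by
      rw [hw ⟨v, hvx.trans_lt hx⟩ ⟨p, hp⟩, hw ⟨u, (huv.trans hvx).trans_lt hx⟩ ⟨p, hp⟩,
        hw ⟨x, hx⟩ ⟨p, hp⟩]
      have h := hE.axisPos_le_max hN hn (u := ⟨u, (huv.trans hvx).trans_lt hx⟩)
        (v := ⟨v, hvx.trans_lt hx⟩) (x := ⟨x, hx⟩) huv hvx ⟨p, hp⟩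
      rcases le_max_iff.1 h with h | h
      · exact le_max_of_le_left (ha.pos_mono E h)
      · exact le_max_of_le_right (ha.pos_mono E h))
    m le_rfl k n le_rfl (blockTable_lt hE hN hn ha hk hkm hw)
  refine ⟨_, fun v => ⟨hg.lt v v.isLt, rfl⟩,
    ⟨hg.isMonroeAssignment le_rfl hq' le_rfl _, fun Ψ hΨ => ?_⟩, hg.hasContiguousBlocks _⟩
  obtain ⟨g, hg'⟩ := hE.exists_isBlockAssignment hN hn ha hk hw hΨ
  refine le_trans ?_ (hg'.blockTable_le (inf := a m + 1))
  rw [linfty_le_iff]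
  intro v
  have := hg.cost_le v v.isLt
  rwa [hw v ⟨_, hg.lt v v.isLt⟩] at this

end Election

/-! ### Reasoning about programs -/

namespace RAMState

@[simp] theorem setReg_reg (s : RAMState) (x v y : ℕ) :
    (s.setReg x v).reg y = if y = x then v else s.reg y := by
  simp [setReg, Function.update_apply]

@[simp] theorem setReg_arr (s : RAMState) (x v : ℕ) : (s.setReg x v).arr = s.arr := rfl

@[simp] theorem setArr_reg (s : RAMState) (a i v : ℕ) : (s.setArr a i v).reg = s.reg := rfl

@[simp] theorem setArr_arr (s : RAMState) (a i v b : ℕ) :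
    (s.setArr a i v).arr b = if b = a then Function.update (s.arr a) i v else s.arr b := by
  simp [setArr, Function.update_apply]

end RAMState

namespace RAMProg

/-- Started in `s`, the program `p` halts within `B` steps in a state that satisfies `Q`. -/
def HaltsIn (p : RAMProg) (s : RAMState) (B : ℕ) (Q : RAMState → Prop) : Prop :=
  ∃ (t : ℕ) (s' : RAMState), p.Runs s t s' ∧ t ≤ B ∧ Q s'

section HaltsIn

variable {p q : RAMProg} {s : RAMState} {B B' : ℕ} {Q Q' : RAMState → Prop}

theorem HaltsIn.mono (h : p.HaltsIn s B Q) (hB : B ≤ B') (hQ : ∀ s', Q s' → Q' s') :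
    p.HaltsIn s B' Q' := by
  obtain ⟨t, s', hr, ht, hs⟩ := h
  exact ⟨t, s', hr, ht.trans hB, hQ s' hs⟩

theorem HaltsIn.seq (h : p.HaltsIn s B fun s' => q.HaltsIn s' B' Q) :
    (RAMProg.seq p q).HaltsIn s (B + B') Q := by
  obtain ⟨t, s', hr, ht, t', s'', hr', ht', hs⟩ := h
  exact ⟨t + t', s'', .seq hr hr', Nat.add_le_add ht ht', hs⟩

/-- The rule for loops with a known number N of iterations; the invariant is indexed by the
iterations completed. -/
theorem HaltsIn.whileLt {x y : ℕ} (I : ℕ → RAMState → Prop) (N : ℕ) (h0 : I 0 s)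
    (hstep : ∀ i < N, ∀ s, I i s → s.reg x < s.reg y ∧ p.HaltsIn s B (I (i + 1)))
    (hend : ∀ s, I N s → ¬ s.reg x < s.reg y) :
    (RAMProg.whileLt x y p).HaltsIn s (N * (B + 1) + 1) (I N) := by
  suffices H : ∀ d i, i + d = N → ∀ s, I i s →
      (RAMProg.whileLt x y p).HaltsIn s (d * (B + 1) + 1) (I N) from H N 0 (zero_add N) s h0
  intro d
  induction d with
  | zero =>
    rintro i rfl s hs
    exact ⟨1, s, .while_false (hend s hs), by simp, hs⟩
  | succ d ih =>
    intro i hi s hs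
    obtain ⟨hlt, t, s', hr, ht, hs'⟩ := hstep i (by omega) s hs
    obtain ⟨t', s'', hr', ht', hs''⟩ := ih (i + 1) (by omega) s' hs'
    refine ⟨t + t' + 1, s'', .while_true hlt hr hr', ?_, hs''⟩
    rw [Nat.succ_mul]
    omega

end HaltsIn

/-- The program has no loops. -/
def LoopFree : RAMProg → Prop
  | seq p q => p.LoopFree ∧ q.LoopFree
  | ifLt _ _ p q => p.LoopFree ∧ q.LoopFree
  | whileLt _ _ _ => False
  | _ => True

/-- The number of instructions and tests of a program. -/
def size : RAMProg → ℕ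
  | seq p q => p.size + q.size
  | ifLt _ _ p q => p.size + q.size + 1
  | whileLt _ _ p => p.size + 1
  | _ => 1

/-- The state in which a program without loops halts. -/
def exec : RAMProg → RAMState → RAMState
  | skip, s => s
  | const x c, s => s.setReg x c
  | copy x y, s => s.setReg x (s.reg y)
  | add x y z, s => s.setReg x (s.reg y + s.reg z)
  | sub x y z, s => s.setReg x (s.reg y - s.reg z)
  | load x a y, s => s.setReg x (s.arr a (s.reg y))
  | store a x y, s => s.setArr a (s.reg x) (s.reg y)
  | seq p q, s => q.exec (p.exec s)
  | ifLt x y p q, s => if s.reg x < s.reg y then p.exec s else q.exec s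
  | whileLt _ _ _, s => s

theorem LoopFree.runs : ∀ {p : RAMProg}, p.LoopFree → ∀ s, ∃ t ≤ p.size, p.Runs s t (p.exec s)
  | .skip, _, s => ⟨1, le_rfl, .skip s⟩
  | .const x c, _, s => ⟨1, le_rfl, .const s x c⟩
  | .copy x y, _, s => ⟨1, le_rfl, .copy s x y⟩
  | .add x y z, _, s => ⟨1, le_rfl, .add s x y z⟩
  | .sub x y z, _, s => ⟨1, le_rfl, .sub s x y z⟩
  | .load x a y, _, s => ⟨1, le_rfl, .load s x a y⟩
  | .store a x y, _, s => ⟨1, le_rfl, .store s a x y⟩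
  | .seq p q, h, s => by
    obtain ⟨t, ht, hr⟩ := LoopFree.runs (p := p) h.1 s
    obtain ⟨t', ht', hr'⟩ := LoopFree.runs (p := q) h.2 (p.exec s)
    exact ⟨t + t', Nat.add_le_add ht ht', .seq hr hr'⟩
  | .ifLt x y p q, h, s => by
    rw [exec]
    split_ifs with hlt
    · obtain ⟨t, ht, hr⟩ := LoopFree.runs (p := p) h.1 s
      exact ⟨t + 1, by rw [size]; omega, .ifLt_true hlt hr⟩
    · obtain ⟨t, ht, hr⟩ := LoopFree.runs (p := q) h.2 s
      exact ⟨t + 1, by rw [size]; omega, .ifLt_false hlt hr⟩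

/-- For code without loops, correctness reduces to evaluating `exec` and the time bound to counting
instructions. -/
theorem LoopFree.haltsIn {p : RAMProg} (h : p.LoopFree) {s : RAMState} {B : ℕ}
    {Q : RAMState → Prop} (hB : p.size ≤ B) (hQ : Q (p.exec s)) : p.HaltsIn s B Q := by
  obtain ⟨t, ht, hr⟩ := h.runs s
  exact ⟨t, _, hr, ht.trans hB, hQ⟩

/-- Execute the list of programs one after the other. -/
def block : List RAMProg → RAMProg
  | [] => skip
  | [p] => p
  | p :: q :: l => seq p (block (q :: l))

/-! #### Renaming of registers and arrays -/

/-- Shift the names of registers by `x₀` and the names of arrays by `a₀`. -/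
def shift (x₀ a₀ : ℕ) : RAMProg → RAMProg
  | skip => skip
  | const x c => const (x + x₀) c
  | copy x y => copy (x + x₀) (y + x₀)
  | add x y z => add (x + x₀) (y + x₀) (z + x₀)
  | sub x y z => sub (x + x₀) (y + x₀) (z + x₀)
  | load x a y => load (x + x₀) (a + a₀) (y + x₀)
  | store a x y => store (a + a₀) (x + x₀) (y + x₀)
  | seq p q => seq (p.shift x₀ a₀) (q.shift x₀ a₀)
  | ifLt x y p q => ifLt (x + x₀) (y + x₀) (p.shift x₀ a₀) (q.shift x₀ a₀)
  | whileLt x y p => whileLt (x + x₀) (y + x₀) (p.shift x₀ a₀)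

/-- The part of the memory that a shifted program uses. -/
def _root_.RAMState.unshift (x₀ a₀ : ℕ) (s : RAMState) : RAMState :=
  ⟨fun x => s.reg (x + x₀), fun a => s.arr (a + a₀)⟩

/-- The state `s` with the part that a shifted program uses replaced by `u`. -/
def _root_.RAMState.overwrite (x₀ a₀ : ℕ) (s u : RAMState) : RAMState :=
  ⟨fun x => if x < x₀ then s.reg x else u.reg (x - x₀),
    fun a => if a < a₀ then s.arr a else u.arr (a - a₀)⟩

section Shift

variable {x₀ a₀ : ℕ} (s u : RAMState)

@[simp] theorem _root_.RAMState.overwrite_reg_add (x : ℕ) :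
    (s.overwrite x₀ a₀ u).reg (x + x₀) = u.reg x := by
  simp [RAMState.overwrite]

@[simp] theorem _root_.RAMState.overwrite_arr_add (a : ℕ) :
    (s.overwrite x₀ a₀ u).arr (a + a₀) = u.arr a := by
  simp [RAMState.overwrite]

theorem _root_.RAMState.overwrite_unshift : s.overwrite x₀ a₀ (s.unshift x₀ a₀) = s := by
  cases s with
  | mk r b =>
    simp only [RAMState.overwrite, RAMState.unshift, RAMState.mk.injEq]
    constructor <;> funext i <;> split_ifs with h
    · rfl
    · rw [Nat.sub_add_cancel (not_lt.1 h)]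
    · rfl
    · rw [Nat.sub_add_cancel (not_lt.1 h)]

theorem _root_.RAMState.overwrite_setReg (x v : ℕ) :
    s.overwrite x₀ a₀ (u.setReg x v) = (s.overwrite x₀ a₀ u).setReg (x + x₀) v := by
  simp only [RAMState.overwrite, RAMState.setReg, RAMState.mk.injEq, and_true]
  funext y
  simp only [Function.update_apply]
  split_ifs <;> first | rfl | omega

theorem _root_.RAMState.overwrite_setArr (a i v : ℕ) :
    s.overwrite x₀ a₀ (u.setArr a i v) = (s.overwrite x₀ a₀ u).setArr (a + a₀) i v := by
  simp only [RAMState.overwrite, RAMState.setArr, RAMState.mk.injEq, true_and]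
  funext b
  simp only [Function.update_apply]
  split_ifs <;> first | rfl | omega | simp

theorem Runs.shift {p : RAMProg} {u u' : RAMState} {t : ℕ} (h : p.Runs u t u') :
    (p.shift x₀ a₀).Runs (s.overwrite x₀ a₀ u) t (s.overwrite x₀ a₀ u') := by
  induction h with
  | skip u => exact .skip _
  | const u x c => rw [RAMState.overwrite_setReg]; exact .const _ _ _
  | copy u x y =>
    rw [RAMState.overwrite_setReg, ← s.overwrite_reg_add u y]; exact .copy _ _ _
  | add u x y z =>
    rw [RAMState.overwrite_setReg, ← s.overwrite_reg_add u y, ← s.overwrite_reg_add u z]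
    exact .add _ _ _ _
  | sub u x y z =>
    rw [RAMState.overwrite_setReg, ← s.overwrite_reg_add u y, ← s.overwrite_reg_add u z]
    exact .sub _ _ _ _
  | load u x a y =>
    rw [RAMState.overwrite_setReg, ← s.overwrite_reg_add u y, ← s.overwrite_arr_add u a]
    exact .load _ _ _ _
  | store u a x y =>
    rw [RAMState.overwrite_setArr, ← s.overwrite_reg_add u x, ← s.overwrite_reg_add u y]
    exact .store _ _ _ _
  | seq _ _ ih ih' => exact .seq ih ih'
  | ifLt_true hlt _ ih => exact .ifLt_true (by simpa using hlt) ih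
  | ifLt_false hlt _ ih => exact .ifLt_false (by simpa using hlt) ih
  | while_true hlt _ _ ih ih' => exact .while_true (by simpa using hlt) ih ih'
  | while_false hlt => exact .while_false (by simpa using hlt)

/-- A shifted program leaves the registers below `x₀` and the arrays below `a₀` unchanged. -/
theorem HaltsIn.shift {p : RAMProg} {B : ℕ} {Q : RAMState → Prop}
    (h : p.HaltsIn (s.unshift x₀ a₀) B Q) :
    (p.shift x₀ a₀).HaltsIn s B fun s' => Q (s'.unshift x₀ a₀) ∧
      (∀ x < x₀, s'.reg x = s.reg x) ∧ ∀ a < a₀, s'.arr a = s.arr a := by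
  obtain ⟨t, u', hr, ht, hQ⟩ := h
  refine ⟨t, s.overwrite x₀ a₀ u', ?_, ht, ?_, ?_, ?_⟩
  · simpa only [RAMState.overwrite_unshift] using hr.shift (x₀ := x₀) (a₀ := a₀) s
  · convert hQ
    cases u'
    simp [RAMState.overwrite, RAMState.unshift]
  · intro x hx
    simp [RAMState.overwrite, hx]
  · intro a ha
    simp [RAMState.overwrite, ha]

end Shift

end RAMProg

/-! ### The program -/

namespace RAMProg

/-- Registers `3, …, 11` are set to `1`, `0`, `n / k`, `n ⌈/⌉ k`, `α m + 1`, `n + 1`, `m + 1`,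
`k + 1` and `(k + 1) * (n + 1)`. -/
def setup : RAMProg :=
  seq (block [const 3 1, const 4 0, add 8 0 3, add 9 1 3, add 10 2 3, load 7 1 1, add 7 7 3,
    const 5 0, copy 12 8])
  (seq (whileLt 2 12 (block [sub 12 12 2, add 5 5 3]))
  (seq (block [ifLt 3 12 (add 6 5 3) (copy 6 5), const 11 0, const 12 0])
    (whileLt 12 10 (block [add 11 11 8, add 12 12 3]))))

/-- Array `5` is filled with the products of `n` and the indices of the candidates on the axis. -/
def fillAxis : RAMProg :=
  seq (block [const 12 0, const 13 0])
    (whileLt 12 1 (block [load 14 0 12, store 5 14 13, add 13 13 0, add 12 12 3]))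

/-- Array `4` is filled with the dissatisfaction of the voters `v` with the candidates of index `p`,
at `p * n + v`. -/
def fillCost : RAMProg :=
  seq (block [const 12 0, const 13 0])
    (whileLt 12 0 (seq (const 14 1) (seq
      (whileLt 14 9 (block [load 15 0 13, load 15 5 15, add 15 15 12, load 16 1 14, store 4 15 16,
        add 13 13 3, add 14 14 3]))
      (add 12 12 3))))

/-- The table for no candidates. -/
def initTable : RAMProg :=
  seq (const 12 0)
    (seq (whileLt 12 11 (block [store 3 12 7, store 6 12 4, add 12 12 3]))
      (store 3 4 4))

/-- Try a last block whose size is in register `x`. -/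
def improveProg (x : ℕ) : RAMProg :=
  ifLt 16 x skip (block [sub 20 17 x, load 20 3 20, add 21 13 16, sub 22 21 x, load 22 4 22,
    ifLt 20 22 (copy 20 22) skip, sub 22 21 3, load 22 4 22, ifLt 20 22 (copy 20 22) skip,
    ifLt 20 18 (seq (copy 18 20) (copy 19 x)) skip])

/-- Compute one entry of the table. -/
def fillEntry : RAMProg :=
  seq (block [sub 17 14 11, load 18 3 17, const 19 0, sub 17 17 8])
    (seq (ifLt 4 15 (seq (improveProg 5) (improveProg 6)) skip)
      (block [store 3 14 18, store 6 14 19, add 14 14 3, add 16 16 3]))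

/-- Arrays `3` and `6` are filled with the two components of the table. -/
def fillTable : RAMProg :=
  seq (block [const 12 0, const 13 0, copy 14 11])
    (whileLt 12 1 (seq (const 15 0) (seq
      (whileLt 15 10 (seq (const 16 0) (seq (whileLt 16 8 fillEntry) (add 15 15 3))))
      (block [add 12 12 3, add 13 13 0]))))

/-- Read off the assignment from the table. -/
def readAssignment : RAMProg :=
  seq (block [sub 14 14 3, copy 16 0])
    (whileLt 4 12 (seq (block [sub 12 12 3, load 17 0 12, load 18 6 14, sub 14 14 11,
        ifLt 4 18 (seq (sub 14 14 8) (sub 14 14 18)) skip, sub 19 16 18])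
      (whileLt 19 16 (block [sub 16 16 3, store 2 16 17]))))

/-- Find an optimal Monroe assignment by dynamic programming. -/
def optimalMonroe : RAMProg :=
  seq setup (seq fillAxis (seq fillCost (seq initTable (seq fillTable readAssignment))))

/-- The contents of the registers after `setup`. -/
structure Params (n m k inf : ℕ) (s : RAMState) : Prop where
  r0 : s.reg 0 = n
  r1 : s.reg 1 = m
  r2 : s.reg 2 = k
  r3 : s.reg 3 = 1
  r4 : s.reg 4 = 0
  r5 : s.reg 5 = n / k
  r6 : s.reg 6 = n ⌈/⌉ k
  r7 : s.reg 7 = inf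
  r8 : s.reg 8 = n + 1
  r9 : s.reg 9 = m + 1
  r10 : s.reg 10 = k + 1
  r11 : s.reg 11 = (k + 1) * (n + 1)

/-! ### Correctness and running time of the phases: preparation -/

section Phases

variable {n m k inf : ℕ} {s : RAMState}

theorem Params.congr {s' : RAMState} (h : Params n m k inf s)
    (h' : ∀ x < 12, s'.reg x = s.reg x) : Params n m k inf s' := by
  constructor <;> rw [h' _ (by norm_num)]
  exacts [h.r0, h.r1, h.r2, h.r3, h.r4, h.r5, h.r6, h.r7, h.r8, h.r9, h.r10, h.r11]

theorem ne_of_lt_twelve {x : ℕ} (hx : x < 12) : ∀ y, 12 ≤ y → x ≠ y := fun y hy => by omega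

/-- Division by repeated subtraction. Register 12 starts at n + 1 because the loop test is strict:
it stops after `n / k` rounds at `n % k + 1`, which exceeds 1 exactly when the ceiling differs from
the floor. -/
theorem setup_haltsIn (hk : 1 ≤ k) (h0 : s.reg 0 = n) (h1 : s.reg 1 = m) (h2 : s.reg 2 = k) :
    setup.HaltsIn s (9 + (n / k * 3 + 1 + (5 + ((k + 1) * 3 + 1))))
      fun s' => Params n m k (s.arr 1 m + 1) s' ∧ s'.arr = s.arr := by
  have hdm := Nat.div_add_mod n k
  refine .seq (LoopFree.haltsIn (by simp [block, LoopFree]) (by simp [block, size]) ?_)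
  refine .seq (HaltsIn.mono (HaltsIn.whileLt (B := 2)
    (fun t s' => s'.arr = s.arr ∧ s'.reg 0 = n ∧ s'.reg 1 = m ∧ s'.reg 2 = k ∧ s'.reg 3 = 1 ∧
      s'.reg 4 = 0 ∧ s'.reg 5 = t ∧ s'.reg 7 = s.arr 1 m + 1 ∧ s'.reg 8 = n + 1 ∧
      s'.reg 9 = m + 1 ∧ s'.reg 10 = k + 1 ∧ s'.reg 12 + t * k = n + 1) (n / k) ?_ ?_ ?_)
    le_rfl ?_)
  · simp [block, exec, h0, h1, h2]
  · rintro t ht s' ⟨ha, g0, g1, g2, g3, g4, g5, g7, g8, g9, g10, g12⟩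
    have h3 : (t + 1) * k ≤ n / k * k := Nat.mul_le_mul_right k ht
    have h4 : n / k * k ≤ n := Nat.div_mul_le_self n k
    rw [Nat.succ_mul] at h3
    refine ⟨by omega, LoopFree.haltsIn (by simp [block, LoopFree]) (by simp [block, size]) ?_⟩
    simp only [block, exec, RAMState.setReg_reg, RAMState.setReg_arr, ha, g0, g1, g2, g3, g4, g5,
      g7, g8, g9, g10, Nat.succ_mul]
    norm_num
    omega
  · rintro s' ⟨ha, g0, g1, g2, g3, g4, g5, g7, g8, g9, g10, g12⟩
    have h5 := Nat.mod_lt n hk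
    rw [Nat.mul_comm] at hdm
    omega
  · rintro s' ⟨ha, g0, g1, g2, g3, g4, g5, g7, g8, g9, g10, g12⟩
    have h5 := Nat.mod_lt n hk
    have hr : s'.reg 12 = n % k + 1 := by
      rw [Nat.mul_comm] at hdm
      omega
    have hc : n ⌈/⌉ k = if 0 < n % k then n / k + 1 else n / k := by
      rw [Nat.ceilDiv_eq_add_pred_div]
      split_ifs with h
      · rw [Nat.div_eq_iff hk, Nat.succ_mul, Nat.mul_comm (n / k)]
        constructor <;> omega
      · rw [Nat.div_eq_iff hk, Nat.mul_comm (n / k)]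
        constructor <;> omega
    refine .seq (LoopFree.haltsIn (by simp [block, LoopFree]) (by simp [block, size]) ?_)
    refine HaltsIn.mono (HaltsIn.whileLt (B := 2)
      (fun t s' => s'.arr = s.arr ∧ s'.reg 0 = n ∧ s'.reg 1 = m ∧ s'.reg 2 = k ∧ s'.reg 3 = 1 ∧
        s'.reg 4 = 0 ∧ s'.reg 5 = n / k ∧ s'.reg 6 = n ⌈/⌉ k ∧ s'.reg 7 = s.arr 1 m + 1 ∧
        s'.reg 8 = n + 1 ∧ s'.reg 9 = m + 1 ∧ s'.reg 10 = k + 1 ∧ s'.reg 11 = t * (n + 1) ∧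
        s'.reg 12 = t) (k + 1) ?_ ?_ ?_) le_rfl ?_
    · simp only [block, exec, g3, hr, hc]
      split_ifs <;>
        first | omega | simp [ha, g0, g1, g2, g3, g4, g5, g7, g8, g9, g10]
    · rintro t ht s' ⟨ha, g0, g1, g2, g3, g4, g5, g6, g7, g8, g9, g10, g11, g12⟩
      refine ⟨by omega, LoopFree.haltsIn (by simp [block, LoopFree]) (by simp [block, size]) ?_⟩
      simp [block, exec, ha, g0, g1, g2, g3, g4, g5, g6, g7, g8, g9, g10, g11, g12, Nat.succ_mul]
    · rintro s' ⟨ha, g0, g1, g2, g3, g4, g5, g6, g7, g8, g9, g10, g11, g12⟩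
      omega
    · rintro s' ⟨ha, g0, g1, g2, g3, g4, g5, g6, g7, g8, g9, g10, g11, g12⟩
      exact ⟨⟨g0, g1, g2, g3, g4, g5, g6, g7, g8, g9, g10, g11⟩, ha⟩

/-- By `hinj` no cell is written twice. Storing p * n instead of p makes the address of a cost a
single addition. -/
theorem fillAxis_haltsIn (h : Params n m k inf s)
    (hinj : ∀ p < m, ∀ p' < m, s.arr 0 p = s.arr 0 p' → p = p') :
    fillAxis.HaltsIn s (2 + (m * 5 + 1)) fun s' => Params n m k inf s' ∧ s'.arr 0 = s.arr 0 ∧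
      s'.arr 1 = s.arr 1 ∧ ∀ p < m, s'.arr 5 (s.arr 0 p) = p * n := by
  refine .seq (LoopFree.haltsIn (by simp [block, LoopFree]) (by simp [block, size]) ?_)
  refine HaltsIn.mono (HaltsIn.whileLt (B := 4) (fun t s' => Params n m k inf s' ∧
    s'.arr 0 = s.arr 0 ∧ s'.arr 1 = s.arr 1 ∧ (∀ p < t, s'.arr 5 (s.arr 0 p) = p * n) ∧
      s'.reg 12 = t ∧ s'.reg 13 = t * n) m ?_ ?_ ?_) le_rfl ?_
  · refine ⟨h.congr fun x hx => ?_, by simp [block, exec]⟩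
    simp [block, exec, ne_of_lt_twelve hx]
  · rintro t ht s' ⟨hp, ha0, ha1, ha5, g12, g13⟩
    refine ⟨by rw [g12, hp.r1]; exact ht,
      LoopFree.haltsIn (by simp [block, LoopFree]) (by simp [block, size]) ?_⟩
    refine ⟨hp.congr fun x hx => ?_, ?_, ?_, fun p hpt => ?_, ?_, ?_⟩
    · simp [block, exec, ne_of_lt_twelve hx]
    · simp [block, exec, ha0]
    · simp [block, exec, ha1]
    · simp only [block, exec]
      simp only [RAMState.setReg_reg, RAMState.setReg_arr, RAMState.setArr_arr, g12, g13, ha0]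
      norm_num
      rcases Nat.lt_succ_iff_lt_or_eq.1 hpt with hlt | rfl
      · rw [Function.update_of_ne, ha5 p hlt]
        exact fun he => hlt.ne (hinj p (hlt.trans ht) t ht he)
      · simp
    · simp [block, exec, g12, hp.r3]
    · simp [block, exec, g13, hp.r0, Nat.succ_mul]
  · rintro s' ⟨hp, -, -, -, g12, -⟩
    rw [g12, hp.r1]
    exact lt_irrefl _
  · rintro s' ⟨hp, ha0, ha1, ha5, -, -⟩
    exact ⟨hp, ha0, ha1, ha5⟩

theorem mul_add_inj {N a b a' b' : ℕ} (hb : b < N) (hb' : b' < N)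
    (h : a * N + b = a' * N + b') : a = a' ∧ b = b' := by
  have h1 : a = a' := by
    have := congrArg (· / N) h
    simpa only [Nat.mul_comm _ N, Nat.mul_add_div (Nat.zero_lt_of_lt hb), Nat.div_eq_of_lt hb,
      Nat.div_eq_of_lt hb', add_zero] using this
  subst h1
  exact ⟨rfl, Nat.add_left_cancel h⟩

theorem fillCost_haltsIn (h : Params n m k inf s) {w ι : ℕ → ℕ → ℕ}
    (hι : ∀ v < n, ∀ r < m, s.arr 5 (s.arr 0 (v * m + r)) = ι v r * n)
    (hw : ∀ v < n, ∀ r < m, w v (ι v r) = s.arr 1 (r + 1)) :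
    fillCost.HaltsIn s (2 + (n * (1 + ((m * 8 + 1) + 1) + 1) + 1)) fun s' =>
      Params n m k inf s' ∧ s'.arr 0 = s.arr 0 ∧
        ∀ v < n, ∀ r < m, s'.arr 4 (ι v r * n + v) = w v (ι v r) := by
  refine .seq (LoopFree.haltsIn (by simp [block, LoopFree]) (by simp [block, size]) ?_)
  refine HaltsIn.mono (HaltsIn.whileLt (B := 1 + ((m * 8 + 1) + 1))
    (fun t s' => Params n m k inf s' ∧
      s'.arr 0 = s.arr 0 ∧ s'.arr 1 = s.arr 1 ∧ s'.arr 5 = s.arr 5 ∧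
      (∀ v < t, ∀ r < m, s'.arr 4 (ι v r * n + v) = w v (ι v r)) ∧
      s'.reg 12 = t ∧ s'.reg 13 = t * m) n ?_ ?_ ?_) le_rfl ?_
  · refine ⟨h.congr fun x hx => ?_, by simp [block, exec]⟩
    simp [block, exec, ne_of_lt_twelve hx]
  · rintro t ht s' ⟨hp, ha0, ha1, ha5, ha4, g12, g13⟩
    refine ⟨by rw [g12, hp.r0]; exact ht,
      .seq (LoopFree.haltsIn (by simp [LoopFree]) (by simp [size]) (.seq (HaltsIn.mono
        (HaltsIn.whileLt (B := 7)
        (fun r₀ s' => Params n m k inf s' ∧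
          s'.arr 0 = s.arr 0 ∧ s'.arr 1 = s.arr 1 ∧ s'.arr 5 = s.arr 5 ∧
          (∀ v < t, ∀ r < m, s'.arr 4 (ι v r * n + v) = w v (ι v r)) ∧
          (∀ r < r₀, s'.arr 4 (ι t r * n + t) = w t (ι t r)) ∧
          s'.reg 12 = t ∧ s'.reg 13 = t * m + r₀ ∧ s'.reg 14 = r₀ + 1) m ?_ ?_ ?_) le_rfl ?_)))⟩
    · refine ⟨hp.congr fun x hx => ?_, ?_⟩
      · simp [exec, ne_of_lt_twelve hx]
      · simpa [exec, ha0, ha1, ha5, g12, g13] using ha4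
    · rintro r₀ hr s' ⟨hp, ha0, ha1, ha5, ha4, ha4', g12, g13, g14⟩
      refine ⟨by rw [g14, hp.r9]; omega,
        LoopFree.haltsIn (by simp [block, LoopFree]) (by simp [block, size]) ?_⟩
      have harr : ((block [load 15 0 13, load 15 5 15, add 15 15 12, load 16 1 14, store 4 15 16,
          add 13 13 3, add 14 14 3]).exec s').arr 4 =
          Function.update (s'.arr 4) (ι t r₀ * n + t) (w t (ι t r₀)) := by
        simp [block, exec, ha0, ha5, ha1, g12, g13, g14, hι t ht r₀ hr, hw t ht r₀ hr]
      -- Equal addresses force the same voter and the same axis index, so a cell that is overwritten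
      -- receives the value it already holds.
      have hst : ∀ v < n, ∀ r, s'.arr 4 (ι v r * n + v) = w v (ι v r) →
          Function.update (s'.arr 4) (ι t r₀ * n + t) (w t (ι t r₀)) (ι v r * n + v) =
            w v (ι v r) := by
        intro v hv r hvr
        by_cases he : ι v r * n + v = ι t r₀ * n + t
        · obtain ⟨h1, h2⟩ := mul_add_inj hv ht he
          rw [he, Function.update_self, h1, h2]
        · rw [Function.update_of_ne he, hvr]
      refine ⟨hp.congr fun x hx => ?_, ?_, ?_, ?_, fun v hv r hr => ?_, fun r hr => ?_, ?_, ?_, ?_⟩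
      · simp [block, exec, ne_of_lt_twelve hx]
      · simp [block, exec, ha0]
      · simp [block, exec, ha1]
      · simp [block, exec, ha5]
      · rw [harr]
        exact hst v (hv.trans ht) r (ha4 v hv r hr)
      · rw [harr]
        rcases Nat.lt_succ_iff_lt_or_eq.1 hr with hlt | rfl
        · exact hst t ht r (ha4' r hlt)
        · rw [Function.update_self]
      · simp [block, exec, g12]
      · simp [block, exec, g13, hp.r3, add_assoc]
      · simp [block, exec, g14, hp.r3]
    · rintro s' ⟨hp, -, -, -, -, -, -, -, g14⟩
      rw [g14, hp.r9]
      exact lt_irrefl _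
    · rintro s' ⟨hp, ha0, ha1, ha5, ha4, ha4', g12, g13, g14⟩
      refine LoopFree.haltsIn (by simp [LoopFree]) (by simp [size])
        ⟨hp.congr fun x hx => ?_, ?_, ?_, ?_, fun v hv r hr => ?_, ?_, ?_⟩
      · simp [exec, ne_of_lt_twelve hx]
      · simp [exec, ha0]
      · simp [exec, ha1]
      · simp [exec, ha5]
      · rcases Nat.lt_succ_iff_lt_or_eq.1 hv with hlt | rfl
        · exact ha4 v hlt r hr
        · exact ha4' r hr
      · simp [exec, g12, hp.r3]
      · simp [exec, g13, Nat.succ_mul]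
  · rintro s' ⟨hp, -, -, -, -, g12, -⟩
    rw [g12, hp.r0]
    exact lt_irrefl _
  · rintro s' ⟨hp, ha0, -, -, ha4, -, -⟩
    exact ⟨hp, ha0, ha4⟩

/-- The address of an entry of the table. -/
def tableIndex (n k c j i : ℕ) : ℕ := (c * (k + 1) + j) * (n + 1) + i

theorem tableIndex_inj {c j i c' j' i' : ℕ} (hj : j ≤ k) (hi : i ≤ n) (hj' : j' ≤ k)
    (hi' : i' ≤ n) (h : tableIndex n k c j i = tableIndex n k c' j' i') :
    c = c' ∧ j = j' ∧ i = i' := by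
  obtain ⟨h1, h2⟩ := mul_add_inj (Nat.lt_succ_of_le hi) (Nat.lt_succ_of_le hi') h
  obtain ⟨h3, h4⟩ := mul_add_inj (Nat.lt_succ_of_le hj) (Nat.lt_succ_of_le hj') h1
  exact ⟨h3, h4, h2⟩

/-- The entries of the table at addresses below `P` are stored in arrays `3` and `6`. -/
def HoldsBlockTable (w : ℕ → ℕ → ℕ) (inf n k P : ℕ) (s : RAMState) : Prop :=
  ∀ c, ∀ j ≤ k, ∀ i ≤ n, tableIndex n k c j i < P →
    s.arr 3 (tableIndex n k c j i) = (blockTable w inf (n / k) (n ⌈/⌉ k) c j i).1 ∧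
      s.arr 6 (tableIndex n k c j i) = (blockTable w inf (n / k) (n ⌈/⌉ k) c j i).2

theorem initTable_haltsIn (h : Params n m k inf s) (w : ℕ → ℕ → ℕ) :
    initTable.HaltsIn s (1 + ((k + 1) * (n + 1) * 4 + 1 + 1)) fun s' =>
      Params n m k inf s' ∧ s'.arr 0 = s.arr 0 ∧ s'.arr 4 = s.arr 4 ∧
        HoldsBlockTable w inf n k (tableIndex n k 1 0 0) s' := by
  refine .seq (LoopFree.haltsIn (by simp [LoopFree]) (by simp [size]) (.seq (HaltsIn.mono
    (HaltsIn.whileLt (B := 3)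
    (fun t s' => Params n m k inf s' ∧ s'.arr 0 = s.arr 0 ∧ s'.arr 4 = s.arr 4 ∧
      (∀ x < t, s'.arr 3 x = inf ∧ s'.arr 6 x = 0) ∧ s'.reg 12 = t) ((k + 1) * (n + 1)) ?_ ?_ ?_)
    le_rfl ?_)))
  · refine ⟨h.congr fun x hx => ?_, by simp [exec]⟩
    simp [exec, ne_of_lt_twelve hx]
  · rintro t ht s' ⟨hp, ha0, ha4, ha, g12⟩
    refine ⟨by rw [g12, hp.r11]; exact ht,
      LoopFree.haltsIn (by simp [block, LoopFree]) (by simp [block, size]) ?_⟩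
    refine ⟨hp.congr fun x hx => ?_, ?_, ?_, fun x hx => ?_, ?_⟩
    · simp [block, exec, ne_of_lt_twelve hx]
    · simp [block, exec, ha0]
    · simp [block, exec, ha4]
    · rcases Nat.lt_succ_iff_lt_or_eq.1 hx with hlt | rfl
      · simpa [block, exec, g12, Function.update_of_ne hlt.ne] using ha x hlt
      · simp [block, exec, g12, hp.r7, hp.r4]
    · simp [block, exec, g12, hp.r3]
  · rintro s' ⟨hp, -, -, -, g12⟩
    rw [g12, hp.r11]
    exact lt_irrefl _
  · rintro s' ⟨hp, ha0, ha4, ha, g12⟩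
    refine LoopFree.haltsIn (by simp [LoopFree]) (by simp [size]) ⟨hp.congr fun x hx => ?_, ?_, ?_,
      fun c j hj i hi hlt => ?_⟩
    · simp [exec]
    · simp [exec, ha0]
    · simp [exec, ha4]
    · have hc : c = 0 := by
        by_contra hc
        have h1 : (1 * (k + 1) + 0) * (n + 1) ≤ (c * (k + 1) + j) * (n + 1) :=
          Nat.mul_le_mul_right _ (Nat.add_le_add
            (Nat.mul_le_mul_right _ (Nat.one_le_iff_ne_zero.2 hc)) (Nat.zero_le _))
        unfold tableIndex at hlt
        omega
      subst hc
      have hx := ha (tableIndex n k 0 j i) (by simpa [tableIndex] using hlt)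
      simp only [exec, RAMState.setArr_arr, hp.r4, blockTable]
      norm_num
      refine ⟨?_, hx.2⟩
      by_cases h0 : j = 0 ∧ i = 0
      · obtain ⟨rfl, rfl⟩ := h0
        simp [tableIndex]
      · rw [if_neg h0, Function.update_of_ne, hx.1]
        contrapose! h0
        have : tableIndex n k 0 j i = tableIndex n k 0 0 0 := by simpa [tableIndex] using h0
        exact (tableIndex_inj hj hi (Nat.zero_le _) (Nat.zero_le _) this).2

end Phases

end RAMProg

namespace RAMProg

/-! ### Correctness and running time of the phases: filling and reading the table -/

section Phases

variable {n m k inf : ℕ} {s : RAMState}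

/-- The hypotheses on the memory assume z ≤ i, since otherwise the program skips the block and reads
nothing. Two tests form the maximum of three values and a third compares it with the best so far;
the proof runs through the outcomes. As x < 12, the scratch registers do not clobber the block size.
-/
theorem improveProg_exec {x i c z : ℕ} {w : ℕ → ℕ → ℕ} {D : ℕ → ℕ} {b : ℕ × ℕ} (hx : x < 12)
    (hz : s.reg x = z) (g3 : s.reg 3 = 1) (g13 : s.reg 13 = c * n) (g16 : s.reg 16 = i)
    (g18 : s.reg 18 = b.1) (g19 : s.reg 19 = b.2)
    (hD : z ≤ i → s.arr 3 (s.reg 17 - z) = D (i - z))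
    (hw : z ≤ i → s.arr 4 (c * n + i - z) = w (i - z) c)
    (hw' : z ≤ i → s.arr 4 (c * n + i - 1) = w (i - 1) c) :
    ((improveProg x).exec s).arr = s.arr ∧
      (∀ y < 18, ((improveProg x).exec s).reg y = s.reg y) ∧
      ((improveProg x).exec s).reg 18 = (improve w c i z D b).1 ∧
      ((improveProg x).exec s).reg 19 = (improve w c i z D b).2 := by
  have hne : ∀ y, 12 ≤ y → x ≠ y := ne_of_lt_twelve hx
  by_cases hi : i < z
  · simp [improveProg, exec, improve, hz, g16, hi, g18, g19]
  have hD := hD (not_lt.1 hi)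
  have hw := hw (not_lt.1 hi)
  have hw' := hw' (not_lt.1 hi)
  have hmax : ∀ a b : ℕ, max a b = if a < b then b else a := fun a b => by
    split_ifs with h
    · exact max_eq_right h.le
    · exact max_eq_left (not_lt.1 h)
  simp only [improve, if_neg hi, hmax]
  generalize D (i - z) = d₀ at *
  generalize w (i - z) c = w₁ at *
  generalize w (i - 1) c = w₂ at *
  by_cases h1 : d₀ < w₁
  · by_cases h2 : w₁ < w₂
    · by_cases h3 : w₂ < b.1 <;>
      · simp [improveProg, block, exec, hne, hz, g3, g13, g16, g18, g19, hi, hD, hw, hw',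
          h1, h2, h3]
        intro y hy
        have hy : ∀ y', 18 ≤ y' → y ≠ y' := fun y' hy' => by omega
        simp [hy]
    · by_cases h3 : w₁ < b.1 <;>
      · simp [improveProg, block, exec, hne, hz, g3, g13, g16, g18, g19, hi, hD, hw, hw',
          h1, h2, h3]
        intro y hy
        have hy : ∀ y', 18 ≤ y' → y ≠ y' := fun y' hy' => by omega
        simp [hy]
  · by_cases h2 : d₀ < w₂
    · by_cases h3 : w₂ < b.1 <;>
      · simp [improveProg, block, exec, hne, hz, g3, g13, g16, g18, g19, hi, hD, hw, hw',
          h1, h2, h3]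
        intro y hy
        have hy : ∀ y', 18 ≤ y' → y ≠ y' := fun y' hy' => by omega
        simp [hy]
    · by_cases h3 : d₀ < b.1 <;>
      · simp [improveProg, block, exec, hne, hz, g3, g13, g16, g18, g19, hi, hD, hw, hw',
          h1, h2, h3]
        intro y hy
        have hy : ∀ y', 18 ≤ y' → y ≠ y' := fun y' hy' => by omega
        simp [hy]

/-- With the next two lemmas: from the address of an entry, its predecessors are reached by
subtractions alone. -/
theorem tableIndex_succ_sub (n k c j i : ℕ) :
    tableIndex n k (c + 1) j i - (k + 1) * (n + 1) = tableIndex n k c j i := by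
  apply Nat.sub_eq_of_eq_add
  unfold tableIndex
  ring

theorem tableIndex_sub_row {j : ℕ} (hj : 0 < j) (n k c i : ℕ) :
    tableIndex n k c j i - (n + 1) = tableIndex n k c (j - 1) i := by
  obtain ⟨j, rfl⟩ := Nat.exists_eq_add_of_lt hj
  apply Nat.sub_eq_of_eq_add
  simp only [zero_add, Nat.add_sub_cancel]
  unfold tableIndex
  ring

theorem tableIndex_sub {s i : ℕ} (hs : s ≤ i) (n k c j : ℕ) :
    tableIndex n k c j i - s = tableIndex n k c j (i - s) := by
  unfold tableIndex
  omega

theorem tableIndex_lt_of_lt {c c' j j' i : ℕ} (hj : j ≤ k) (hi : i ≤ n) (hc : c < c') (i' : ℕ) :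
    tableIndex n k c j i < tableIndex n k c' j' i' := by
  have h1 : (c * (k + 1) + j) * (n + 1) + (n + 1) ≤ (c' * (k + 1) + j') * (n + 1) := by
    rw [← Nat.succ_mul]
    apply Nat.mul_le_mul_right
    have : (c + 1) * (k + 1) ≤ c' * (k + 1) := Nat.mul_le_mul_right _ hc
    rw [Nat.succ_mul] at this
    omega
  unfold tableIndex
  omega

/-- The recursion consults only entries for one candidate fewer, whose addresses are all smaller and
hence already filled. -/
theorem fillEntry_haltsIn (h : Params n m k inf s) {w : ℕ → ℕ → ℕ} {c j i : ℕ}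
    (hq : 1 ≤ n / k) (hw : ∀ v < n, s.arr 4 (c * n + v) = w v c) (hj : j ≤ k) (hi : i ≤ n)
    (g13 : s.reg 13 = c * n) (g14 : s.reg 14 = tableIndex n k (c + 1) j i) (g15 : s.reg 15 = j)
    (g16 : s.reg 16 = i) (hT : HoldsBlockTable w inf n k (tableIndex n k (c + 1) j i) s) :
    fillEntry.HaltsIn s (4 + (40 + 4)) fun s' => Params n m k inf s' ∧ s'.arr 0 = s.arr 0 ∧
      s'.arr 4 = s.arr 4 ∧ s'.reg 12 = s.reg 12 ∧ s'.reg 13 = c * n ∧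
      s'.reg 14 = tableIndex n k (c + 1) j i + 1 ∧ s'.reg 15 = j ∧ s'.reg 16 = i + 1 ∧
      HoldsBlockTable w inf n k (tableIndex n k (c + 1) j i + 1) s' := by
  set s₁ := (block [sub 17 14 11, load 18 3 17, const 19 0, sub 17 17 8]).exec s with hs₁
  have f₁ : ∀ x < 17, s₁.reg x = s.reg x := fun x hx => by
    have hne : ∀ y, 17 ≤ y → x ≠ y := fun y hy => by omega
    simp [hs₁, block, exec, hne]
  have a₁ : s₁.arr = s.arr := by simp [hs₁, block, exec]
  -- For j = 0 this is not the address of a predecessor, but it is used only if 0 < j.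
  have e₁₇ : s₁.reg 17 = tableIndex n k c j i - (n + 1) := by
    simp [hs₁, block, exec, g14, h.r8, h.r11, tableIndex_succ_sub]
  have e₁₈ : s₁.reg 18 = (blockTable w inf (n / k) (n ⌈/⌉ k) c j i).1 := by
    rw [← (hT c j hj i hi (tableIndex_lt_of_lt hj hi c.lt_succ_self _)).1]
    simp [hs₁, block, exec, g14, h.r11, tableIndex_succ_sub]
  have e₁₉ : s₁.reg 19 = 0 := by simp [hs₁, block, exec]
  have h₁ : Params n m k inf s₁ := h.congr fun x hx => f₁ x (by omega)
  set s₂ := (ifLt 4 15 (seq (improveProg 5) (improveProg 6)) skip).exec s₁ with hs₂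
  have key : s₂.arr = s.arr ∧ (∀ y < 17, s₂.reg y = s.reg y) ∧
      s₂.reg 18 = (blockTable w inf (n / k) (n ⌈/⌉ k) (c + 1) j i).1 ∧
      s₂.reg 19 = (blockTable w inf (n / k) (n ⌈/⌉ k) (c + 1) j i).2 := by
    rw [hs₂, exec, h₁.r4, f₁ 15 (by norm_num), g15]
    by_cases hj0 : 0 < j
    · have hD : ∀ z ≤ i, s.arr 3 (tableIndex n k c (j - 1) i - z) =
          (fun i => (blockTable w inf (n / k) (n ⌈/⌉ k) c (j - 1) i).1) (i - z) := by
        intro z hz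
        rw [tableIndex_sub hz]
        exact (hT c (j - 1) (by omega) (i - z) (by omega)
          (tableIndex_lt_of_lt (by omega) (by omega) c.lt_succ_self _)).1
      have hW : ∀ z, 1 ≤ z → z ≤ i → s.arr 4 (c * n + i - z) = w (i - z) c := by
        intro z hz hzi
        rw [← hw (i - z) (by omega), Nat.add_sub_assoc hzi]
      have hq' := hq.trans (div_le_ceilDiv n k)
      rw [tableIndex_sub_row hj0] at e₁₇
      obtain ⟨b1, b2, b3, b4⟩ := improveProg_exec (s := s₁) (x := 5) (w := w)
        (D := fun i => (blockTable w inf (n / k) (n ⌈/⌉ k) c (j - 1) i).1)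
        (b := ((blockTable w inf (n / k) (n ⌈/⌉ k) c j i).1, 0)) (by norm_num) h₁.r5 h₁.r3
        ((f₁ 13 (by norm_num)).trans g13) ((f₁ 16 (by norm_num)).trans g16) e₁₈ e₁₉
        (fun hz => by rw [a₁, e₁₇]; exact hD _ hz) (fun hz => by rw [a₁]; exact hW _ hq hz)
        (fun hz => by rw [a₁]; exact hW 1 le_rfl (hq.trans hz))
      obtain ⟨c1, c2, c3, c4⟩ := improveProg_exec (s := (improveProg 5).exec s₁) (x := 6)
        (w := w) (D := fun i => (blockTable w inf (n / k) (n ⌈/⌉ k) c (j - 1) i).1) (by norm_num)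
        ((b2 6 (by norm_num)).trans h₁.r6) ((b2 3 (by norm_num)).trans h₁.r3)
        (((b2 13 (by norm_num)).trans (f₁ 13 (by norm_num))).trans g13)
        (((b2 16 (by norm_num)).trans (f₁ 16 (by norm_num))).trans g16) b3 b4
        (fun hz => by rw [b1, b2 17 (by norm_num), a₁, e₁₇]; exact hD _ hz)
        (fun hz => by rw [b1, a₁]; exact hW _ hq' hz)
        (fun hz => by rw [b1, a₁]; exact hW 1 le_rfl (hq'.trans hz))
      rw [if_pos hj0, exec, blockTable, if_pos hj0]
      exact ⟨c1.trans (b1.trans a₁), fun y hy => (c2 y (by omega)).trans ((b2 y (by omega)).trans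
        (f₁ y hy)), c3, c4⟩
    · rw [if_neg hj0, exec, blockTable, if_neg hj0]
      exact ⟨a₁, f₁, e₁₈, e₁₉⟩
  clear_value s₁ s₂
  obtain ⟨a₂, f₂, e₂₁₈, e₂₁₉⟩ := key
  have h₂ : Params n m k inf s₂ := h.congr fun x hx => f₂ x (by omega)
  refine .seq (LoopFree.haltsIn (B := 4) (by simp [block, LoopFree]) (by simp [block, size]) ?_)
  rw [← hs₁]
  refine .seq (LoopFree.haltsIn (B := 40) (by simp [improveProg, block, LoopFree])
    (by simp [improveProg, block, size]) ?_)
  rw [← hs₂]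
  refine LoopFree.haltsIn (by simp [block, LoopFree]) (by simp [block, size])
    ⟨h₂.congr fun x hx => ?_, ?_, ?_, ?_, ?_, ?_, ?_, ?_, fun c' j' hj' i' hi' hlt => ?_⟩
  · simp [block, exec, ne_of_lt_twelve hx]
  · simp [block, exec, a₂]
  · simp [block, exec, a₂]
  · simp [block, exec, f₂]
  · simp [block, exec, f₂, g13]
  · simp [block, exec, f₂, g14, h.r3]
  · simp [block, exec, f₂, g15]
  · simp [block, exec, f₂, g16, h.r3]
  · have E3 : ((block [store 3 14 18, store 6 14 19, add 14 14 3, add 16 16 3]).exec s₂).arr 3 =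
        Function.update (s.arr 3) (tableIndex n k (c + 1) j i)
          (blockTable w inf (n / k) (n ⌈/⌉ k) (c + 1) j i).1 := by
      simp [block, exec, a₂, f₂, g14, e₂₁₈]
    have E6 : ((block [store 3 14 18, store 6 14 19, add 14 14 3, add 16 16 3]).exec s₂).arr 6 =
        Function.update (s.arr 6) (tableIndex n k (c + 1) j i)
          (blockTable w inf (n / k) (n ⌈/⌉ k) (c + 1) j i).2 := by
      simp [block, exec, a₂, f₂, g14, e₂₁₉]
    rw [E3, E6]
    rcases Nat.lt_succ_iff_lt_or_eq.1 hlt with hlt | heq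
    · rw [Function.update_of_ne hlt.ne, Function.update_of_ne hlt.ne]
      exact hT c' j' hj' i' hi' hlt
    · obtain ⟨rfl, rfl, rfl⟩ := tableIndex_inj hj' hi' hj hi heq
      simp

theorem fillTable_haltsIn (h : Params n m k inf s) {w : ℕ → ℕ → ℕ} (hq : 1 ≤ n / k)
    (hw : ∀ p < m, ∀ v < n, s.arr 4 (p * n + v) = w v p)
    (hT : HoldsBlockTable w inf n k (tableIndex n k 1 0 0) s) :
    fillTable.HaltsIn s (3 + (m * (1 + (((k + 1) * (1 + (((n + 1) * 49 + 1) + 1) + 1) + 1) + 2) + 1)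
        + 1)) fun s' => Params n m k inf s' ∧ s'.arr 0 = s.arr 0 ∧ s'.reg 12 = m ∧
      s'.reg 14 = tableIndex n k (m + 1) 0 0 ∧
      HoldsBlockTable w inf n k (tableIndex n k (m + 1) 0 0) s' := by
  refine .seq (LoopFree.haltsIn (by simp [block, LoopFree]) (by simp [block, size]) ?_)
  refine HaltsIn.mono (HaltsIn.whileLt
    (B := 1 + (((k + 1) * (1 + (((n + 1) * 49 + 1) + 1) + 1) + 1) + 2))
    (fun c s' => Params n m k inf s' ∧ s'.arr 0 = s.arr 0 ∧ s'.arr 4 = s.arr 4 ∧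
      s'.reg 12 = c ∧ s'.reg 13 = c * n ∧ s'.reg 14 = tableIndex n k (c + 1) 0 0 ∧
      HoldsBlockTable w inf n k (tableIndex n k (c + 1) 0 0) s') m ?_ ?_ ?_) le_rfl ?_
  · refine ⟨h.congr fun x hx => ?_, ?_⟩
    · simp [block, exec, ne_of_lt_twelve hx]
    · refine ⟨by simp [block, exec], by simp [block, exec], by simp [block, exec],
        by simp [block, exec], by simp [block, exec, h.r11, tableIndex], ?_⟩
      simpa [HoldsBlockTable, block, exec] using hT
  · rintro c hc s' ⟨hp, ha0, ha4, g12, g13, g14, hT⟩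
    refine ⟨by rw [g12, hp.r1]; exact hc,
      .seq (LoopFree.haltsIn (by simp [LoopFree]) (by simp [size]) (.seq (HaltsIn.mono
        (HaltsIn.whileLt (B := 1 + (((n + 1) * 49 + 1) + 1))
        (fun j s' => Params n m k inf s' ∧ s'.arr 0 = s.arr 0 ∧ s'.arr 4 = s.arr 4 ∧
          s'.reg 12 = c ∧ s'.reg 13 = c * n ∧ s'.reg 14 = tableIndex n k (c + 1) j 0 ∧
          s'.reg 15 = j ∧ HoldsBlockTable w inf n k (tableIndex n k (c + 1) j 0) s')
          (k + 1) ?_ ?_ ?_) le_rfl ?_)))⟩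
    · refine ⟨hp.congr fun x hx => ?_, ?_⟩
      · simp [exec, ne_of_lt_twelve hx]
      · refine ⟨by simp [exec, ha0], by simp [exec, ha4], by simp [exec, g12],
          by simp [exec, g13], by simp [exec, g14], by simp [exec], ?_⟩
        simpa [HoldsBlockTable, exec] using hT
    · rintro j hj s' ⟨hp, ha0, ha4, g12, g13, g14, g15, hT⟩
      refine ⟨by rw [g15, hp.r10]; exact hj,
        .seq (LoopFree.haltsIn (by simp [LoopFree]) (by simp [size]) (.seq (HaltsIn.mono
          (HaltsIn.whileLt (B := 48)
          (fun i s' => Params n m k inf s' ∧ s'.arr 0 = s.arr 0 ∧ s'.arr 4 = s.arr 4 ∧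
            s'.reg 12 = c ∧ s'.reg 13 = c * n ∧ s'.reg 14 = tableIndex n k (c + 1) j i ∧
            s'.reg 15 = j ∧ s'.reg 16 = i ∧
            HoldsBlockTable w inf n k (tableIndex n k (c + 1) j i) s')
            (n + 1) ?_ ?_ ?_) le_rfl ?_)))⟩
      · refine ⟨hp.congr fun x hx => ?_, ?_⟩
        · simp [exec, ne_of_lt_twelve hx]
        · refine ⟨by simp [exec, ha0], by simp [exec, ha4], by simp [exec, g12],
            by simp [exec, g13], by simp [exec, g14], by simp [exec, g15], by simp [exec], ?_⟩
          simpa [HoldsBlockTable, exec] using hT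
      · rintro i hi s' ⟨hp, ha0, ha4, g12, g13, g14, g15, g16, hT⟩
        refine ⟨by rw [g16, hp.r8]; exact hi, (fillEntry_haltsIn hp hq (fun v hv => ?_)
          (Nat.lt_succ_iff.1 hj) (Nat.lt_succ_iff.1 hi) g13 g14 g15 g16 hT).mono le_rfl ?_⟩
        · rw [ha4, hw c hc v hv]
        · rintro s'' ⟨hp', ha0', ha4', g12', g13', g14', g15', g16', hT'⟩
          exact ⟨hp', ha0'.trans ha0, ha4'.trans ha4, g12'.trans g12, g13', g14', g15', g16', hT'⟩
      · rintro s' ⟨hp, -, -, -, -, -, -, g16, -⟩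
        rw [g16, hp.r8]
        exact lt_irrefl _
      · rintro s' ⟨hp, ha0, ha4, g12, g13, g14, g15, g16, hT⟩
        -- The cell after the last entry of a row is the first entry of the next row, so the address
        -- register only needs increments.
        have he : tableIndex n k (c + 1) j (n + 1) = tableIndex n k (c + 1) (j + 1) 0 := by
          unfold tableIndex
          ring
        rw [he] at g14 hT
        refine LoopFree.haltsIn (by simp [LoopFree]) (by simp [size])
          ⟨hp.congr fun x hx => ?_, ?_⟩
        · simp [exec, ne_of_lt_twelve hx]
        · refine ⟨by simp [exec, ha0], by simp [exec, ha4], by simp [exec, g12],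
            by simp [exec, g13], by simp [exec, g14], by simp [exec, g15, hp.r3], ?_⟩
          simpa [HoldsBlockTable, exec] using hT
    · rintro s' ⟨hp, -, -, -, -, -, g15, -⟩
      rw [g15, hp.r10]
      exact lt_irrefl _
    · rintro s' ⟨hp, ha0, ha4, g12, g13, g14, g15, hT⟩
      have he : tableIndex n k (c + 1) (k + 1) 0 = tableIndex n k (c + 1 + 1) 0 0 := by
        unfold tableIndex
        ring
      rw [he] at g14 hT
      refine LoopFree.haltsIn (by simp [block, LoopFree]) (by simp [block, size])
        ⟨hp.congr fun x hx => ?_, ?_⟩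
      · simp [block, exec, ne_of_lt_twelve hx]
      · refine ⟨by simp [block, exec, ha0], by simp [block, exec, ha4],
          by simp [block, exec, g12, hp.r3], by simp [block, exec, g13, hp.r0, Nat.succ_mul],
          by simp [block, exec, g14], ?_⟩
        simpa [HoldsBlockTable, block, exec] using hT
  · rintro s' ⟨hp, -, -, g12, -⟩
    rw [g12, hp.r1]
    exact lt_irrefl _
  · rintro s' ⟨hp, ha0, -, g12, -, g14, hT⟩
    exact ⟨hp, ha0, g12, g14, hT⟩

/-- Invariant of the trace: it stands at an entry (c, j, i) of value below `inf`, the voters from i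
on are written, and those below i remain to be assigned by `blockAssign` at that entry. The number j
is kept only implicitly, in the address. -/
theorem readAssignment_haltsIn (h : Params n m k inf s) {w : ℕ → ℕ → ℕ} (hq : 1 ≤ n / k)
    (g12 : s.reg 12 = m) (g14 : s.reg 14 = tableIndex n k (m + 1) 0 0)
    (hT : HoldsBlockTable w inf n k (tableIndex n k (m + 1) 0 0) s)
    (hlt : (blockTable w inf (n / k) (n ⌈/⌉ k) m k n).1 < inf) :
    readAssignment.HaltsIn s (2 + (m * ((9 + (n * 3 + 1)) + 1) + 1)) fun s' => ∀ v < n,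
      s'.arr 2 v = s.arr 0 (blockAssign w inf (n / k) (n ⌈/⌉ k) m k n v) := by
  refine .seq (LoopFree.haltsIn (by simp [block, LoopFree]) (by simp [block, size]) ?_)
  refine HaltsIn.mono (HaltsIn.whileLt (B := 9 + (n * 3 + 1))
    (fun t s' => Params n m k inf s' ∧ s'.arr 0 = s.arr 0 ∧
      HoldsBlockTable w inf n k (tableIndex n k (m + 1) 0 0) s' ∧ ∃ c j i, c + t = m ∧ j ≤ k ∧
        i ≤ n ∧ s'.reg 12 = c ∧ s'.reg 14 = tableIndex n k c j i ∧ s'.reg 16 = i ∧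
        (blockTable w inf (n / k) (n ⌈/⌉ k) c j i).1 < inf ∧
        (∀ v < i, blockAssign w inf (n / k) (n ⌈/⌉ k) m k n v =
          blockAssign w inf (n / k) (n ⌈/⌉ k) c j i v) ∧
        ∀ v, i ≤ v → v < n →
          s'.arr 2 v = s.arr 0 (blockAssign w inf (n / k) (n ⌈/⌉ k) m k n v)) m ?_ ?_ ?_) le_rfl ?_
  · refine ⟨h.congr fun x hx => ?_, by simp [block, exec], ?_, m, k, n, rfl, le_rfl, le_rfl, ?_, ?_,
      ?_, hlt, fun _ _ => rfl, fun v hv hv' => absurd hv' hv.not_gt⟩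
    · simp [block, exec, ne_of_lt_twelve hx]
    · simpa [HoldsBlockTable, block, exec] using hT
    · simp [block, exec, g12]
    · have : tableIndex n k (m + 1) 0 0 = tableIndex n k m k n + 1 := by
        unfold tableIndex
        ring
      simp [block, exec, g14, h.r3, this]
    · simp [block, exec, h.r0]
  · rintro t ht s' ⟨hp, ha0, hT, c, j, i, hct, hj, hi, g12, g14, g16, hlt, heq, hout⟩
    obtain ⟨c, rfl⟩ : ∃ c', c = c' + 1 := ⟨c - 1, by omega⟩
    refine ⟨by rw [hp.r4, g12]; exact c.succ_pos, ?_⟩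
    set z := (blockTable w inf (n / k) (n ⌈/⌉ k) (c + 1) j i).2 with hz
    have hzi : z ≤ i := blockTable_snd_le c j i
    have hz6 : s'.arr 6 (tableIndex n k (c + 1) j i) = z :=
      (hT (c + 1) j hj i hi (tableIndex_lt_of_lt hj hi (by omega) _)).2
    have hpred := (blockTable_pred_le (w := w) (inf := inf) hq (hq.trans (div_le_ceilDiv n k))
      c j i).trans_lt hlt
    have hstep : ∀ v < i, blockAssign w inf (n / k) (n ⌈/⌉ k) m k n v =
        if i - z ≤ v then c else blockAssign w inf (n / k) (n ⌈/⌉ k) c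
          (if z = 0 then j else j - 1) (i - z) v := fun v hv => by
      rw [heq v hv, blockAssign]
    set s₁ := (block [sub 12 12 3, load 17 0 12, load 18 6 14, sub 14 14 11,
      ifLt 4 18 (seq (sub 14 14 8) (sub 14 14 18)) skip, sub 19 16 18]).exec s' with hs₁
    have key : Params n m k inf s₁ ∧ s₁.arr = s'.arr ∧ s₁.reg 12 = c ∧ s₁.reg 16 = i ∧
        s₁.reg 17 = s.arr 0 c ∧ s₁.reg 19 = i - z ∧
        s₁.reg 14 = tableIndex n k c (if z = 0 then j else j - 1) (i - z) := by
      by_cases hz0 : z = 0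
      · refine ⟨hp.congr fun x hx => ?_, ?_, ?_, ?_, ?_, ?_, ?_⟩
        · simp [hs₁, block, exec, ne_of_lt_twelve hx, hp.r4, g14, hz6, hz0]
        all_goals simp [hs₁, block, exec, hp.r4, hp.r3, hp.r11, g12, g14, g16, ha0, hz6, hz0,
          tableIndex_succ_sub]
      · have hz0' := Nat.pos_of_ne_zero hz0
        have hj0 : 0 < j := pos_of_blockTable_snd_ne_zero hz0
        refine ⟨hp.congr fun x hx => ?_, ?_, ?_, ?_, ?_, ?_, ?_⟩
        · simp [hs₁, block, exec, ne_of_lt_twelve hx, hp.r4, g14, hz6, hz0']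
        all_goals simp [hs₁, block, exec, hp.r4, hp.r3, hp.r11, hp.r8, g12, g14, g16, ha0, hz6,
          hz0', hz0, tableIndex_succ_sub, tableIndex_sub_row hj0, tableIndex_sub hzi]
    clear_value s₁
    obtain ⟨h₁, a₁, e12, e16, e17, e19, e14⟩ := key
    refine .seq (LoopFree.haltsIn (B := 9) (by simp [block, LoopFree]) (by simp [block, size]) ?_)
    rw [← hs₁]
    refine HaltsIn.mono (HaltsIn.whileLt (B := 2)
      (fun u s'' => Params n m k inf s'' ∧ s''.arr 0 = s.arr 0 ∧ s''.arr 3 = s'.arr 3 ∧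
        s''.arr 6 = s'.arr 6 ∧ s''.reg 12 = c ∧ s''.reg 17 = s.arr 0 c ∧ s''.reg 19 = i - z ∧
        s''.reg 14 = tableIndex n k c (if z = 0 then j else j - 1) (i - z) ∧
        s''.reg 16 = i - u ∧ ∀ v, i - u ≤ v → v < n →
          s''.arr 2 v = s.arr 0 (blockAssign w inf (n / k) (n ⌈/⌉ k) m k n v)) z ?_ ?_ ?_) ?_ ?_
    · refine ⟨h₁, ?_, ?_, ?_, e12, e17, e19, e14, e16, fun v hv hv' => ?_⟩
      · rw [a₁, ha0]
      · rw [a₁]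
      · rw [a₁]
      · rw [a₁]
        exact hout v hv hv'
    · rintro u hu s'' ⟨hp, ha0, ha3, ha6, g12, g17, g19, g14, g16, hout⟩
      refine ⟨by rw [g19, g16]; omega, LoopFree.haltsIn (by simp [block, LoopFree])
        (by simp [block, size]) ⟨hp.congr fun x hx => ?_, ?_, ?_, ?_, ?_, ?_, ?_, ?_, ?_,
          fun v hv hv' => ?_⟩⟩
      · simp [block, exec, ne_of_lt_twelve hx]
      · simp [block, exec, ha0]
      · simp [block, exec, ha3]
      · simp [block, exec, ha6]
      · simp [block, exec, g12]
      · simp [block, exec, g17]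
      · simp [block, exec, g19]
      · simp [block, exec, g14]
      · simp [block, exec, g16, hp.r3, Nat.sub_sub]
      · have E2 : ((block [sub 16 16 3, store 2 16 17]).exec s'').arr 2 =
            Function.update (s''.arr 2) (i - (u + 1)) (s.arr 0 c) := by
          simp [block, exec, g16, g17, hp.r3, Nat.sub_sub]
        rw [E2]
        by_cases he : v = i - (u + 1)
        · rw [he, Function.update_self, hstep _ (by omega), if_pos (by omega)]
        · rw [Function.update_of_ne he]
          exact hout v (by omega) hv'
    · rintro s'' ⟨hp, ha0, ha3, ha6, g12, g17, g19, g14, g16, hout⟩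
      omega
    · have := Nat.mul_le_mul_right 3 (hzi.trans hi)
      omega
    · rintro s'' ⟨hp, ha0, ha3, ha6, g12, g17, g19, g14, g16, hout⟩
      refine ⟨hp, ha0, ?_, c, _, i - z, by omega, ?_, by omega, g12, g14, g16, hpred,
        fun v hv => ?_, hout⟩
      · unfold HoldsBlockTable
        rw [ha3, ha6]
        exact hT
      · split_ifs <;> omega
      · rw [hstep v (by omega), if_neg (by omega)]
  · rintro s' ⟨hp, -, -, c, j, i, hct, -, -, g12, -⟩
    rw [hp.r4, g12]
    omega
  · rintro s' ⟨-, -, -, c, j, i, hct, -, -, -, -, -, hlt, -, hout⟩ v hv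
    obtain rfl : c = 0 := by omega
    -- Without candidates, a value below `inf` leaves no voters, so the whole output is written.
    obtain ⟨-, rfl⟩ := eq_zero_of_blockTable_zero_lt hlt
    exact hout v v.zero_le hv

end Phases

end RAMProg

/-! ### Assembling the program, and tabulating a family of dissatisfaction functions -/

namespace RAMProg

/-- Fill array `1` with the values that `p` computes for the number of candidates and their
positions. -/
def tabulate (p : RAMProg) : RAMProg :=
  seq (block [const 3 1, copy 10 3, add 9 1 3])
    (whileLt 10 9 (seq (block [copy 32 1, copy 33 10])
      (seq (p.shift 32 8) (block [store 1 10 32, add 10 10 3]))))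

/-- A bound for the running time of `optimalMonroe`, as the sum of those of its six phases. -/
def optimalMonroeTime (n m k : ℕ) : ℕ :=
  (9 + (n / k * 3 + 1 + (5 + ((k + 1) * 3 + 1)))) + ((2 + (m * 5 + 1)) +
    ((2 + (n * (1 + ((m * 8 + 1) + 1) + 1) + 1)) + ((1 + ((k + 1) * (n + 1) * 4 + 1 + 1)) +
      ((3 + (m * (1 + (((k + 1) * (1 + (((n + 1) * 49 + 1) + 1) + 1) + 1) + 2) + 1) + 1)) +
        (2 + (m * ((9 + (n * 3 + 1)) + 1) + 1))))))

theorem optimalMonroeTime_le {n m k : ℕ} (hn : 0 < n) (hm : 0 < m) (hk : 0 < k) :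
    optimalMonroeTime n m k ≤ 1000 * (n * m ^ 2 * k) := by
  unfold optimalMonroeTime
  have hdiv : n / k ≤ n := Nat.div_le_self n k
  have e1 : 1 ≤ m * k := Nat.mul_pos hm hk
  -- Each monomial of the time bound is compared with n * m ^ 2 * k, directly or through another
  -- one; the final step is then linear in the monomials.
  have e2 : n * m ≤ n * m * (m * k) := Nat.le_mul_of_pos_right _ e1
  have e3 : n * k ≤ n * k * (m * m) := Nat.le_mul_of_pos_right _ (Nat.mul_pos hm hm)
  have e4 : n * m * k ≤ n * m * k * m := Nat.le_mul_of_pos_right _ hm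
  have e5 : m * k ≤ m * k * (n * m) := Nat.le_mul_of_pos_right _ (Nat.mul_pos hn hm)
  have e6 : n ≤ n * m := Nat.le_mul_of_pos_right _ hm
  have e7 : m ≤ m * k := Nat.le_mul_of_pos_right _ hk
  have e8 : k ≤ n * k := Nat.le_mul_of_pos_left _ hn
  ring_nf at *
  omega

theorem optimalMonroe_haltsIn {n m k : ℕ} {E : Election n m} {a : ℕ → ℕ} {s : RAMState}
    (ha : IsDissatisfaction m a) (hE : E.SingleCrossing) (hN : E.Narcissistic) (hk : 1 ≤ k)
    (hkm : k ≤ m) (hs : s.HoldsInput E k) (ht : s.HoldsTable m a) :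
    optimalMonroe.HaltsIn s (1000 * (n * m ^ 2 * k)) fun s' => ∃ Φ : Fin n → Fin m,
      s'.HoldsAssignment Φ ∧ E.IsOptimalMonroe a k Φ ∧ HasContiguousBlocks Φ := by
  obtain ⟨h0, h1, h2, hA⟩ := hs
  have hm : 0 < m := hk.trans hkm
  have hn : 0 < n := hm.trans_le hN.le
  have hq : 1 ≤ n / k := (Nat.le_div_iff_mul_le hk).2 (by simpa using hkm.trans hN.le)
  -- The costs and the axis indices are extended by 0 outside the ranges of voters and candidates.
  set w : ℕ → ℕ → ℕ := fun v p =>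
    if h : v < n ∧ p < m then a (E.axisPos hn ⟨v, h.1⟩ ⟨p, h.2⟩) else 0 with hw
  have hwF : ∀ (v : Fin n) (p : Fin m), w v p = a (E.axisPos hn v p) := fun v p => by
    simp [hw]
  set ι : ℕ → ℕ → ℕ := fun v r => if h : v < n ∧ r < m then
    ((E.ranking ⟨0, hn⟩).symm (E.ranking ⟨v, h.1⟩ ⟨r, h.2⟩) : ℕ) else 0 with hι
  have hιF : ∀ (v : Fin n) (r : Fin m), ι v r = (E.ranking ⟨0, hn⟩).symm (E.ranking v r) :=
    fun v r => by simp [hι]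
  have hA' : ∀ (v : Fin n) (r : Fin m), s.arr 0 (v * m + r) = E.ranking v r := hA
  have hA0 : ∀ p : Fin m, s.arr 0 p = E.ranking ⟨0, hn⟩ p := fun p => by
    simpa using hA ⟨0, hn⟩ p
  refine HaltsIn.mono (B := optimalMonroeTime n m k) ?_ (optimalMonroeTime_le hn hm hk) fun _ h => h
  refine .seq ((setup_haltsIn hk h0 h1 h2).mono le_rfl ?_)
  rintro s₁ ⟨p₁, a₁⟩
  refine .seq ((fillAxis_haltsIn p₁ fun p hp p' hp' he => ?_).mono le_rfl ?_)
  · rw [a₁, hA0 ⟨p, hp⟩, hA0 ⟨p', hp'⟩, Fin.val_inj] at he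
    simpa using he
  rintro s₂ ⟨p₂, a₂, b₂, c₂⟩
  rw [a₁] at a₂ b₂ c₂
  refine .seq ((fillCost_haltsIn p₂ (w := w) (ι := ι) (fun v hv r hr => ?_)
    fun v hv r hr => ?_).mono le_rfl ?_)
  · rw [hιF ⟨v, hv⟩ ⟨r, hr⟩, ← c₂ _ (Fin.is_lt _), hA0, a₂, hA' ⟨v, hv⟩ ⟨r, hr⟩]
    simp
  · rw [hιF ⟨v, hv⟩ ⟨r, hr⟩, hwF ⟨v, hv⟩, b₂, ht (r + 1) (by omega) hr]
    simp [Election.axisPos, Election.pos_ranking]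
  rintro s₃ ⟨p₃, a₃, c₃⟩
  refine .seq ((initTable_haltsIn p₃ w).mono le_rfl ?_)
  rintro s₄ ⟨p₄, a₄, b₄, c₄⟩
  refine .seq ((fillTable_haltsIn p₄ (w := w) hq (fun p hp v hv => ?_) c₄).mono le_rfl ?_)
  · set r := (E.ranking ⟨v, hv⟩).symm (E.ranking ⟨0, hn⟩ ⟨p, hp⟩)
    have := c₃ v hv r r.isLt
    rwa [hιF ⟨v, hv⟩ r, Equiv.apply_symm_apply, Equiv.symm_apply_apply, ← b₄] at this
  rintro s₅ ⟨p₅, a₅, g12, g14, c₅⟩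
  have hinf : s.arr 1 m = a m := ht m hm le_rfl
  rw [hinf] at p₅ c₅
  refine (readAssignment_haltsIn p₅ (w := w) hq g12 g14 c₅
    (Election.blockTable_lt hE hN hn ha hk hkm hwF)).mono le_rfl fun s₆ h₆ => ?_
  obtain ⟨Φ, hΦ, hopt⟩ := Election.exists_isOptimalMonroe_blockAssign hE hN hn ha hk hkm hwF
  refine ⟨Φ, fun v => ?_, hopt⟩
  obtain ⟨hlt, hv⟩ := hΦ v
  rw [h₆ v v.isLt, a₅, a₄, a₃, a₂, hv]
  exact hA0 ⟨_, hlt⟩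

/-- Shifting by 32 and 8 moves the given program beyond all registers and arrays used elsewhere, so
the input and the table survive. What an earlier call leaves behind is harmless, because the program
must work on uninitialized memory. -/
theorem tabulate_haltsIn {p : RAMProg} {α : ℕ → ℕ → ℕ} {T : ℕ → ℕ} (hp : p.ComputesFamily α T)
    {n m k : ℕ} {E : Election n m} {s : RAMState} (hs : s.HoldsInput E k) :
    p.tabulate.HaltsIn s (3 + (m * ((2 + (T m + 2)) + 1) + 1)) fun s' =>
      s'.HoldsInput E k ∧ s'.HoldsTable m (α m) := by
  obtain ⟨h0, h1, h2, hA⟩ := hs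
  refine .seq (LoopFree.haltsIn (by simp [block, LoopFree]) (by simp [block, size]) ?_)
  refine HaltsIn.mono (HaltsIn.whileLt (B := 2 + (T m + 2)) (fun t s' => s'.reg 0 = n ∧
    s'.reg 1 = m ∧ s'.reg 2 = k ∧ s'.reg 3 = 1 ∧ s'.reg 9 = m + 1 ∧ s'.reg 10 = t + 1 ∧
    s'.arr 0 = s.arr 0 ∧ ∀ i, 1 ≤ i → i ≤ t → s'.arr 1 i = α m i) m ?_ ?_ ?_) le_rfl ?_
  · simp only [block, exec, RAMState.setReg_reg, RAMState.setReg_arr, h0, h1, h2]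
    norm_num
    omega
  · rintro t ht s' ⟨g0, g1, g2, g3, g9, g10, a0, a1⟩
    refine ⟨by omega, .seq (LoopFree.haltsIn (by simp [block, LoopFree]) (by simp [block, size])
      (.seq ((HaltsIn.shift (x₀ := 32) (a₀ := 8)
        (Q := fun s' => s'.reg 0 = α m (t + 1)) _ ?_).mono le_rfl ?_)))⟩
    · obtain ⟨t', s'', hr, hle, h⟩ := hp m (t + 1) (by omega) ht
        (((block [copy 32 1, copy 33 10]).exec s').unshift 32 8)
        (by simp [RAMState.unshift, block, exec, g1])
        (by simp [RAMState.unshift, block, exec, g10])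
      exact ⟨t', s'', hr, hle, h⟩
    · rintro s'' ⟨hα, hreg, harr⟩
      have hα : s''.reg 32 = α m (t + 1) := hα
      have hreg : ∀ x < 32, s''.reg x = s'.reg x := fun x hx => by
        have hne : ∀ y, 32 ≤ y → x ≠ y := fun y hy => by omega
        rw [hreg x hx]
        simp [block, exec, hne]
      have harr : ∀ b < 8, s''.arr b = s'.arr b := fun b hb => by
        rw [harr b hb]
        simp [block, exec]
      refine LoopFree.haltsIn (by simp [block, LoopFree]) (by simp [block, size]) ?_
      refine ⟨?_, ?_, ?_, ?_, ?_, ?_, ?_, fun i hi hit => ?_⟩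
      · simp [block, exec, hreg, g0]
      · simp [block, exec, hreg, g1]
      · simp [block, exec, hreg, g2]
      · simp [block, exec, hreg, g3]
      · simp [block, exec, hreg, g9]
      · simp [block, exec, hreg, g10, g3]
      · simp [block, exec, harr, a0]
      · have E1 : ((block [store 1 10 32, add 10 10 3]).exec s'').arr 1 =
            Function.update (s'.arr 1) (t + 1) (α m (t + 1)) := by
          simp [block, exec, hreg, harr, g10, hα]
        rw [E1]
        by_cases he : i = t + 1
        · rw [he, Function.update_self]
        · rw [Function.update_of_ne he]
          exact a1 i hi (by omega)
  · rintro s' ⟨-, -, -, -, g9, g10, -⟩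
    omega
  · rintro s' ⟨g0, g1, g2, -, -, -, a0, a1⟩
    exact ⟨⟨g0, g1, g2, fun v r => by rw [a0]; exact hA v r⟩, a1⟩

theorem HaltsIn.findsOptimalMonroe {n m k B : ℕ} {E : Election n m} {a : ℕ → ℕ} {p : RAMProg}
    {s : RAMState} (h : p.HaltsIn s B fun s' => ∃ Φ : Fin n → Fin m,
      s'.HoldsAssignment Φ ∧ E.IsOptimalMonroe a k Φ ∧ HasContiguousBlocks Φ) :
    p.FindsOptimalMonroe s B E a k := by
  obtain ⟨t, s', hr, ht, Φ, hΦ⟩ := h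
  exact ⟨t, s', Φ, hr, ht, hΦ⟩

end RAMProg

theorem theorem7 :
    (∃ (Q : RAMProg) (K : ℕ), ∀ (n m k : ℕ) (E : Election n m) (a : ℕ → ℕ),
      IsDissatisfaction m a → E.SingleCrossing → E.Narcissistic → 1 ≤ k → k ≤ m →
        ∀ s : RAMState, s.HoldsInput E k → s.HoldsTable m a →
          Q.FindsOptimalMonroe s (K * (n * m ^ 2 * k)) E a k) ∧
    (∀ α : ℕ → ℕ → ℕ, (∀ m : ℕ, 1 ≤ m → IsDissatisfaction m (α m)) →
      ∀ (P : RAMProg) (T : Polynomial ℕ), P.ComputesFamily α (fun m => T.eval m) →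
        ∃ (Q : RAMProg) (K : ℕ), ∀ (n m k : ℕ) (E : Election n m),
          E.SingleCrossing → E.Narcissistic → 1 ≤ k → k ≤ m →
            ∀ s : RAMState, s.HoldsInput E k →
              Q.FindsOptimalMonroe s (K * (n * m ^ 2 * k + m * T.eval m)) E (α m) k) := by
  refine ⟨⟨RAMProg.optimalMonroe, 1000, fun n m k E a ha hE hN hk hkm s hs ht =>
    (RAMProg.optimalMonroe_haltsIn ha hE hN hk hkm hs ht).findsOptimalMonroe⟩,
    fun α hα P T hP => ⟨.seq P.tabulate .optimalMonroe, 1010, fun n m k E hE hN hk hkm s hs => ?_⟩⟩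
  have hm : 1 ≤ m := hk.trans hkm
  refine RAMProg.HaltsIn.findsOptimalMonroe (((RAMProg.tabulate_haltsIn hP hs).mono le_rfl
    fun s' hs' => RAMProg.optimalMonroe_haltsIn (hα m hm) hE hN hk hkm hs'.1 hs'.2).seq.mono ?_
    fun _ h => h)
  -- Tabulation takes at most m * T(m) + 5m + 4 steps. Both 1 and m are at most n * m ^ 2 * k, so
  -- this adds at most 9 to the constant 1000, and 1010 suffices.
  have hX : 1 ≤ n * m ^ 2 * k := Nat.mul_pos (Nat.mul_pos (hm.trans hN.le) (pow_pos hm 2)) hk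
  have hle : m ≤ n * m ^ 2 * k := by
    calc m ≤ m * (n * m * k) :=
          Nat.le_mul_of_pos_right _ (Nat.mul_pos (Nat.mul_pos (hm.trans hN.le) hm) hk)
      _ = n * m ^ 2 * k := by ring
  have he : m * (2 + (T.eval m + 2) + 1) = m * T.eval m + 5 * m := by ring
  rw [he]
  omega
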